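/- **Notation.** $\mathbb N=\{1,2,\dots\}$, and $[\mathbb N]^{<\omega}$ is the set of finite subsets of $\mathbb N$. For non-empty finite $s,t\subseteq\mathbb N$ write $s<t$ if $\max s<\min t$; also put $\{n\}<\emptyset$. $\mathcal B^{<\omega}(\mathbb N)$ is the set of all *finite disjoint collections* $\mathbf s=(s_1<\dots<s_k)$ of non-empty finite subsets of $\mathbb N$, including $\emptyset$; an *infinite disjoint collection* is a sequence $s_1<s_2<\cdots$ of non-empty finite subsets of $\mathbb N$. Collections are identified with the sets of their members. $FU(\cdot)$ is the set of all unions of finitely many (at least one) members of a collection, $\mathcal B^{<\omega}(\mathcal D)=\{\mathbf s\in\mathcal B^{<\omega}(\mathbb N):\mathbf s\subseteq FU(\mathcal D)\}$, and for infinite disjoint collections $\mathcal D_1<\mathcal D$ means $\mathcal D_1\subseteq FU(\mathcal D)$. All $\mathcal D,\mathcal D_1,\mathcal D_2$ below are infinite disjoint collections. $\mathbf t\propto\mathbf s$ means that $\mathbf t$ is an initial segment of $\mathbf s$. For $\mathcal F\subseteq\mathcal B^{<\omega}(\mathbb N)$ let $\mathcal F^*=\{\mathbf t\in\mathcal B^{<\omega}(\mathbb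 N):\mathbf t\propto\mathbf s\text{ for some }\mathbf s\in\mathcal F\}\cup\{\emptyset\}$; $\mathcal F$ is a *tree* if $\mathcal F^*=\mathcal F$. Its largest hereditary subfamily is $\mathcal F_h=\{\mathbf s\in\mathcal F:\text{every }\mathbf t\in\mathcal B^{<\omega}(\mathbb N)\text{ with }\mathbf t\subseteq FU(\mathbf s)\text{ belongs to }\mathcal F\}\cup\{\emptyset\}$. A family is *pointwise closed* if the set of characteristic functions of its members is closed in the product space $\{0,1\}^{[\mathbb N]^{<\omega}}$. **Schreier families.** For every countable limit ordinal $\lambda\neq0$ fix any strictly increasing sequence $(\lambda_n)_{n\ge1}$ of successor ordinals below $\lambda$ with supremum $\lambda$. Define $\mathcal A_\xi\subseteq[\mathbb N]^{<\omega}$ for $\xi<\omega_1$ recursively: $\mathcal A_0=\{\emptyset\}$; $\mathcal A_{\zeta+1}=\{\{n\}\cup s:n\in\mathbb N,\ \{n\}<s\in\mathcal A_\zeta\}$; $\mathcal A_{\omega^{\beta+1}}=\{\bigcup_{i=1}^n s_i: s_1<\dots<s_n\text{ in }\mathcal A_{\omega^\beta},\ n=\min s_1\}$; $\mathcal A_{\omega^\lambda}=\{s\neq\emptyset: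 s\in\mathcal A_{\omega^{\lambda_n}},\ n=\min s\}$ for limit $\lambda\neq0$; and if $\xi=\omega^{a_0}p_0+\dots+\omega^{a_m}p_m$ with $a_0>\dots>a_m>0$, natural numbers $p_i\ge1$, and $p_0>1$ or $m\ge1$, then $\mathcal A_\xi$ consists of all $s_m\cup\dots\cup s_1\cup s_0$ with $s_m<\dots<s_1<s_0$, each $s_i$ being the union of sets $s^i_1<\dots<s^i_{p_i}$ in $\mathcal A_{\omega^{a_i}}$. Put $\mathcal B^0=\{\emptyset\}$ and, for $1\le\xi<\omega_1$, $\mathcal B^\xi=\{(s_1<\dots<s_k)\in\mathcal B^{<\omega}(\mathbb N):k\ge1,\ \{\min s_1,\dots,\min s_k\}\in\mathcal A_\xi\}$. **Strong Cantor–Bendixson index.** For $\mathcal G\subseteq\mathcal B^{<\omega}(\mathbb N)$ let $(\mathcal G)^1_{\mathcal D}$ be the set of $\mathbf s\in\mathcal G\cap\mathcal B^{<\omega}(\mathcal D)$ for which $\{t\in FU(\mathcal D):\mathbf s\cup\{t\}\notin\mathcal G\}$ contains no infinite disjoint collection. Put $(\mathcal G)^0_{\mathcal D}=\mathcal G$,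 $(\mathcal G)_{\mathcal D}^{\zeta+1}=((\mathcal G)^\zeta_{\mathcal D})^1_{\mathcal D}$, and $(\mathcal G)^\xi_{\mathcal D}=\bigcap_{\beta<\xi}(\mathcal G)^\beta_{\mathcal D}$ for limit $\xi\neq0$. The index $s_{\mathcal D}(\mathcal G)$ is the least countable $\xi$ with $(\mathcal G)^\xi_{\mathcal D}=\emptyset$. **Theorem 3.3 (Theorem B).** Let $\mathcal F\subseteq\mathcal B^{<\omega}(\mathbb N)$ be a tree and $\mathcal D$ an infinite disjoint collection. *Case 1.* If $\mathcal F_h\cap\mathcal B^{<\omega}(\mathcal D)$ is not pointwise closed, then there is $\mathcal D_1<\mathcal D$ with $\mathcal B^{<\omega}(\mathcal D_1)\subseteq\mathcal F$. *Case 2.* If $\mathcal F_h\cap\mathcal B^{<\omega}(\mathcal D)$ is pointwise closed, then $s_{\mathcal D_1}(\mathcal F_h)$ is defined for every $\mathcal D_1<\mathcal D$, the ordinal $\zeta=\sup\{s_{\mathcal D_1}(\mathcal F_h):\mathcal D_1<\mathcal D\}$ is countable, and for every $\xi<\omega_1$: (i) if $\xi+1<\zeta$, then there is $\mathcal D_2<\mathcal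 D$ with $\mathcal B^\xi\cap\mathcal B^{<\omega}(\mathcal D_2)\subseteq\mathcal F$; (ii) if $\xi>\zeta$, then for every $\mathcal D_1<\mathcal D$ there is $\mathcal D_2<\mathcal D_1$ with $\mathcal B^\xi\cap\mathcal B^{<\omega}(\mathcal D_2)\subseteq\mathcal B^{<\omega}(\mathbb N)\setminus\mathcal F$ and (equivalently) $\mathcal F\cap\mathcal B^{<\omega}(\mathcal D_2)\subseteq(\mathcal B^\xi)^*\setminus\mathcal B^\xi$; (iii) if $\xi+1=\zeta$ or $\xi=\zeta$, then there is $\mathcal D_2<\mathcal D$ such that either $\mathcal B^\xi\cap\mathcal B^{<\omega}(\mathcal D_2)\subseteq\mathcal F$ or $\mathcal B^\xi\cap\mathcal B^{<\omega}(\mathcal D_2)\subseteq\mathcal B^{<\omega}(\mathbb N)\setminus\mathcal F$. -/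

import Mathlib

open scoped Ordinal

/-! The natural numbers of the text are `{1, 2, …}`, i.e. `ℕ+`.  A finite collection of finite sets
of natural numbers is a `Finset (Finset ℕ+)`, an infinite one a `Set (Finset ℕ+)`. -/

namespace BlockSchreier

/-- `s < t` for finite sets of natural numbers (`max s < min t` if both are nonempty). -/
def BlockLT (s t : Finset ℕ+) : Prop := ∀ a ∈ s, ∀ b ∈ t, a < b

/-- Disjoint collections (finite or infinite): the members are nonempty finite sets, and of two
different members one lies entirely before the other.  (Ordering the members by their minima, such
a collection is a finite sequence `s₁ < ⋯ < sₖ` or an infinite sequence `s₁ < s₂ < ⋯`.) -/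
def IsDisjointCollection (S : Set (Finset ℕ+)) : Prop :=
  (∀ a ∈ S, a.Nonempty) ∧ S.Pairwise (fun a b => BlockLT a b ∨ BlockLT b a)

/-- `𝓑^{<ω}(ℕ)`: all finite disjoint collections, including the empty one. -/
def finColl : Set (Finset (Finset ℕ+)) := {s | IsDisjointCollection (s : Set (Finset ℕ+))}

/-- `𝓑^ω(ℕ)`: all infinite disjoint collections. -/
def infColl : Set (Set (Finset ℕ+)) := {D | D.Infinite ∧ IsDisjointCollection D}

/-- `FU(S)`: all unions of finitely many (at least one) members of `S`. -/
def FU (S : Set (Finset ℕ+)) : Set (Finset ℕ+) :=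
  {u | ∃ T : Finset (Finset ℕ+), T.Nonempty ∧ (T : Set (Finset ℕ+)) ⊆ S ∧ u = T.biUnion id}

/-- `𝓑^{<ω}(D)`: all finite disjoint collections with members in `FU(D)`. -/
def finCollIn (D : Set (Finset ℕ+)) : Set (Finset (Finset ℕ+)) :=
  {s | s ∈ finColl ∧ (s : Set (Finset ℕ+)) ⊆ FU D}

/-- `𝓑^ω(D)`: all infinite disjoint collections `D₁` with `D₁ < D`, i.e. `D₁ ⊆ FU(D)`. -/
def infCollIn (D : Set (Finset ℕ+)) : Set (Set (Finset ℕ+)) :=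
  {D₁ | D₁ ∈ infColl ∧ D₁ ⊆ FU D}

/-- `t ∝ s`: `t` is an initial segment (possibly empty, possibly all) of `s`. -/
def IsInitial (t s : Finset (Finset ℕ+)) : Prop :=
  t ⊆ s ∧ ∀ a ∈ t, ∀ b ∈ s, b ∉ t → BlockLT a b

/-- `𝓕^*`: the initial segments of the members of `𝓕`, together with `∅`. -/
def initialClosure (F : Set (Finset (Finset ℕ+))) : Set (Finset (Finset ℕ+)) :=
  {t | t ∈ finColl ∧ ∃ s ∈ F, IsInitial t s} ∪ {∅}

/-- `𝓕` is a tree: `𝓕^* = 𝓕`. -/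
def IsTree (F : Set (Finset (Finset ℕ+))) : Prop := initialClosure F = F

/-- `𝓕_h`, the largest hereditary subfamily of `𝓕`: the members `s` of `𝓕` such that every finite
disjoint collection contained in `FU(s)` belongs to `𝓕`, together with `∅`. -/
def hereditaryPart (F : Set (Finset (Finset ℕ+))) : Set (Finset (Finset ℕ+)) :=
  {s | s ∈ F ∧ ∀ t ∈ finColl, (t : Set (Finset ℕ+)) ⊆ FU (s : Set (Finset ℕ+)) → t ∈ F} ∪ {∅}

/-- The characteristic function of a finite collection, a point of `{0,1}^{[ℕ]^{<ω}}`. -/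
def charFun (s : Finset (Finset ℕ+)) : Finset ℕ+ → Bool := fun a => decide (a ∈ s)

/-- `𝓕` is pointwise closed: its set of characteristic functions is closed in the product
topology of `{0,1}^{[ℕ]^{<ω}}`. -/
def PointwiseClosed (F : Set (Finset (Finset ℕ+))) : Prop := IsClosed (charFun '' F)

/-- A choice, for each countable limit ordinal `l ≠ 0`, of a strictly increasing sequence
`(lam l n)`, `n = 1, 2, …`, of successor ordinals smaller than `l` with supremum `l`. -/
def IsFundamentalSystem (lam : Ordinal.{0} → ℕ+ → Ordinal.{0}) : Prop :=
  ∀ l : Ordinal.{0}, Order.IsSuccLimit l → l < ω_ 1 →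
    StrictMono (lam l) ∧ (∀ n, (∃ β, lam l n = β + 1) ∧ lam l n < l) ∧
      IsLUB (Set.range (lam l)) l

/-- `Schreier lam ξ s` says that `s ∈ 𝓐_ξ`, the recursive thin Schreier system with respect to the
choice `lam` of sequences.  The premises of each clause concern strictly smaller ordinals, and
exactly one clause applies to each countable `ξ`, so this is a definition by recursion on `ξ`. -/
inductive Schreier (lam : Ordinal.{0} → ℕ+ → Ordinal.{0}) : Ordinal.{0} → Finset ℕ+ → Prop
  /-- `𝓐_0 = {∅}`. -/
  | zero : Schreier lam 0 ∅
  /-- `𝓐_{ζ+1}`: the sets `{n} ∪ s` with `{n} < s` and `s ∈ 𝓐_ζ`. -/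
  | succ (ζ : Ordinal.{0}) (n : ℕ+) (s : Finset ℕ+) (hn : BlockLT {n} s)
      (hs : Schreier lam ζ s) : Schreier lam (ζ + 1) (insert n s)
  /-- `𝓐_{ω^{β+1}}`: the unions of `s₁ < ⋯ < sₙ` in `𝓐_{ω^β}`, where `n = min s₁`. -/
  | omega_succ (β : Ordinal.{0}) (n : ℕ+) (t : Fin (n : ℕ) → Finset ℕ+)
      (hn : IsLeast (t ⟨0, n.pos⟩ : Set ℕ+) n)
      (hlt : ∀ i j, i < j → BlockLT (t i) (t j))
      (ht : ∀ i, Schreier lam (ω ^ β) (t i)) :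
      Schreier lam (ω ^ (β + 1)) (Finset.univ.biUnion t)
  /-- `𝓐_{ω^l}`, `l` a limit: the sets `s` in `𝓐_{ω^{lₙ}}`, where `n = min s`. -/
  | omega_limit (l : Ordinal.{0}) (hl : Order.IsSuccLimit l) (n : ℕ+) (s : Finset ℕ+)
      (hn : IsLeast (s : Set ℕ+) n) (hs : Schreier lam (ω ^ lam l n) s) :
      Schreier lam (ω ^ l) s
  /-- `𝓐_ξ` for `ξ = ω^{a₀} p₀ + ω^{a₁} p₁ + ⋯ + ω^{aₘ} pₘ` with `a₀ > a₁ > ⋯ > aₘ > 0`, all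
  `pᵢ ≥ 1`, and `p₀ > 1` or `m ≥ 1`: the unions of sets `sₘ < ⋯ < s₁ < s₀`, where each `sᵢ` is a
  union of `pᵢ` successive sets `t i 0 < t i 1 < ⋯` in `𝓐_{ω^{aᵢ}}`. -/
  | sum (m : ℕ) (a : Fin (m + 1) → Ordinal.{0}) (p : Fin (m + 1) → ℕ)
      (t : (i : Fin (m + 1)) → Fin (p i) → Finset ℕ+)
      (ha : StrictAnti a) (ha0 : ∀ i, 0 < a i) (hp : ∀ i, 1 ≤ p i) (hpm : 1 < p 0 ∨ 1 ≤ m)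
      (hlt : ∀ i x y, x < y → BlockLT (t i x) (t i y))
      (hlt' : ∀ i j, i < j → ∀ x y, BlockLT (t j y) (t i x))
      (ht : ∀ i x, Schreier lam (ω ^ a i) (t i x)) :
      Schreier lam (List.ofFn fun i => ω ^ a i * (p i : Ordinal.{0})).sum
        (Finset.univ.biUnion fun i => Finset.univ.biUnion (t i))

/-- `𝓑^ξ`: the finite disjoint collections `(s₁, …, sₖ)` with `{min s₁, …, min sₖ} ∈ 𝓐_ξ`.
(Since `𝓐_0 = {∅}`, and `∅ ∉ 𝓐_ξ` for `ξ ≥ 1`, this gives `𝓑^0 = {∅}` and `∅ ∉ 𝓑^ξ` for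
`ξ ≥ 1`.) -/
def blockSchreier (lam : Ordinal.{0} → ℕ+ → Ordinal.{0}) (ξ : Ordinal.{0}) :
    Set (Finset (Finset ℕ+)) :=
  {s | s ∈ finColl ∧ ∃ A : Finset ℕ+, Schreier lam ξ A ∧
    (A : Set ℕ+) = {m | ∃ a ∈ s, IsLeast (a : Set ℕ+) m}}

/-- The first strong block Cantor–Bendixson derivative of `G` on `D`. -/
def cbStep (D : Set (Finset ℕ+)) (G : Set (Finset (Finset ℕ+))) : Set (Finset (Finset ℕ+)) :=
  {s | s ∈ G ∩ finCollIn D ∧ ¬ ∃ E ∈ infColl, E ⊆ {t | t ∈ FU D ∧ s ∪ {t} ∉ G}}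

/-- The strong block Cantor–Bendixson derivatives of `G` on `D`, by transfinite iteration, with
intersections at limit stages (and stage `0` equal to `G`). -/
noncomputable def cbDeriv (D : Set (Finset ℕ+)) (G : Set (Finset (Finset ℕ+)))
    (ξ : Ordinal.{0}) : Set (Finset (Finset ℕ+)) :=
  Ordinal.limitRecOn ξ G (fun _ H => cbStep D H) (fun η _ H => ⋂ β, ⋂ h : β < η, H β h)

/-- The strong block Cantor–Bendixson index `s_D(G)`: the least countable ordinal at which the
derivative is empty. -/
noncomputable def cbIndex (D : Set (Finset ℕ+)) (G : Set (Finset (Finset ℕ+))) : Ordinal.{0} :=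
  sInf {ξ | ξ < ω_ 1 ∧ cbDeriv D G ξ = ∅}

/-- `sup {s_{D₁}(G) : D₁ < D}`. -/
noncomputable def cbSup (D : Set (Finset ℕ+)) (G : Set (Finset (Finset ℕ+))) : Ordinal.{0} :=
  sSup {η | ∃ D₁ ∈ infCollIn D, η = cbIndex D₁ G}

end BlockSchreier

namespace BlockSchreier

/-! ### Fundamental sequences -/

/-! The recursive families 𝓐_ξ are replaced by descending walks on ordinals. Every `ξ ≠ 0` receives
a fundamental sequence `fundSeq lam ξ`, arranged so that for countable ξ a set A lies in 𝓐_ξ exactly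
when passing to the n-th term for the successive n in A leads from ξ to 0, without stopping earlier
(`schreier_iff_reach`). The ordinal ρ left over after a collection s, its residual, then acts as a
rank on the tree of initial segments of 𝓑^ξ.

Two facts carry the theorem. The first is a Ramsey dichotomy (`exists_homogeneous`), by induction on
ξ: after removal of a first block a, members of 𝓑^ξ become members of the family for the smaller
ordinal `fundSeq lam ξ (minOf a)`. Fusion decides every a on the tail behind it, and Hindman's
theorem makes the decisions agree.

The second compares the derivatives of a hereditary G with residuals. If G misses 𝓑^ξ on D, members
of the η-th derivative have residual at least 1 + η (`IsHereditary.add_le_of_mem_cbDeriv`); if G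
contains 𝓑^ξ on D, residual at least η suffices for membership in that derivative
(`IsHereditary.mem_cbDeriv_of_reach`). At s = ∅ this bounds the index of G from above or below in
terms of ξ. Applied to F_h, the two bounds give (i) and (ii); in (ii) a member of 𝓑^ξ with fewest
blocks links F to F_h (`IsTree.exists_mem_hereditaryPart`). Part (iii) is the dichotomy for F
itself.

Closedness of F_h on D means that no infinite collection X below D has all its finite parts in F_h
(`pointwiseClosed_iff`). Such an X yields 𝓑^{<ω}(X) ⊆ F; in its absence, extension by later blocks
within F_h is well-founded, and countable suprema along it bound all indices at once. -/

/-- The fundamental sequence of `ω ^ c` determined by `lam`. -/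
noncomputable def powFS (lam : Ordinal.{0} → ℕ+ → Ordinal.{0}) (c : Ordinal.{0}) :
    ℕ+ → Ordinal.{0} :=
  Ordinal.limitRecOn c (fun _ => 0)
    -- A member of 𝓐_{ω^(b+1)} with least element n consists of n successive members of 𝓐_{ω^b}.
    -- Once n is read, the first is in progress and n - 1 are still to come; these stand on the left
    -- because the walk consumes the rightmost term first.
    (fun b g n => ω ^ b * ((n : ℕ) - 1 : ℕ) + g n)
    (fun l _ g n => open Classical in if h : lam l n < l then g (lam l n) h n else 0)

variable (lam : Ordinal.{0} → ℕ+ → Ordinal.{0})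

theorem powFS_zero (n : ℕ+) : powFS lam 0 n = 0 := by
  simp [powFS]

theorem powFS_add_one (b : Ordinal.{0}) (n : ℕ+) :
    powFS lam (b + 1) n = ω ^ b * ((n : ℕ) - 1 : ℕ) + powFS lam b n := by
  simp [powFS]

theorem powFS_limit {l : Ordinal.{0}} (hl : Order.IsSuccLimit l) {n : ℕ+} (h : lam l n < l) :
    powFS lam l n = powFS lam (lam l n) n := by
  simp only [powFS]
  rw [Ordinal.limitRecOn_limit _ _ _ _ hl, dif_pos h]

theorem powFS_lt (c : Ordinal.{0}) (n : ℕ+) : powFS lam c n < ω ^ c := by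
  induction c using Ordinal.limitRecOn with
  | zero => simp [powFS_zero]
  | add_one b ih =>
    rw [powFS_add_one]
    have h1 : (((n : ℕ) - 1 : ℕ) : Ordinal.{0}) + 1 = (n : ℕ) := by
      exact_mod_cast congrArg (Nat.cast (R := Ordinal.{0})) (Nat.sub_add_cancel n.pos)
    calc ω ^ b * (((n : ℕ) - 1 : ℕ) : Ordinal.{0}) + powFS lam b n
        < ω ^ b * (((n : ℕ) - 1 : ℕ) : Ordinal.{0}) + ω ^ b := by gcongr
      _ = ω ^ b * (n : ℕ) := by rw [← h1, mul_add, mul_one]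
      _ < ω ^ (b + 1) := Ordinal.opow_mul_lt_opow (Ordinal.natCast_lt_omega0 _) (lt_add_one b)
  | limit l hl ih =>
    by_cases h : lam l n < l
    · rw [powFS_limit lam hl h]
      exact (ih _ h).trans ((Ordinal.opow_lt_opow_iff_right Ordinal.one_lt_omega0).2 h)
    · simp only [powFS]
      rw [Ordinal.limitRecOn_limit _ _ _ _ hl, dif_neg h]
      exact Ordinal.opow_pos _ Ordinal.omega0_pos

variable {lam} in
-- At a limit c each `lam c n` is a successor γ + 1, so `powFS` begins with ω^γ * (n - 1), which is
-- at least ω^μ for μ ≤ γ once n ≥ 2. This is where the requirement of successor terms enters.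
theorem eventually_le_powFS (hlam : IsFundamentalSystem lam) {c η : Ordinal.{0}} (hc : c < ω_ 1)
    (hη : η < ω ^ c) : ∃ N : ℕ+, ∀ n, N ≤ n → η ≤ powFS lam c n := by
  rcases Ordinal.zero_or_succ_or_isSuccLimit c with rfl | ⟨b, rfl⟩ | hl
  · exact ⟨1, fun n _ => by simp_all⟩
  · obtain ⟨k, hk⟩ := Ordinal.lt_omega0_opow_succ.1 hη
    refine ⟨k.succPNat, fun n hn => ?_⟩
    rw [Order.succ_eq_add_one, powFS_add_one]
    refine hk.le.trans (le_trans ?_ le_self_add)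
    have : k ≤ (n : ℕ) - 1 := by
      have : (k.succPNat : ℕ) ≤ n := hn
      simp at this; omega
    gcongr
  · obtain ⟨μ, hμ, hημ⟩ := (Ordinal.lt_opow_of_isSuccLimit Ordinal.omega0_ne_zero hl).1 hη
    obtain ⟨hmono, hsucc, hlub⟩ := hlam c hl hc
    obtain ⟨_, ⟨N, rfl⟩, hN⟩ := (lt_isLUB_iff hlub).1 hμ
    refine ⟨max N 2, fun n hn => ?_⟩
    obtain ⟨⟨γ, hγ⟩, hlt⟩ := hsucc n
    have hN' : μ < lam c n := hN.trans_le (hmono.monotone ((le_max_left _ _).trans hn))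
    rw [powFS_limit lam hl hlt, hγ, powFS_add_one]
    rw [hγ, Order.lt_add_one_iff] at hN'
    have h2 : 1 ≤ (n : ℕ) - 1 := by
      have : (2 : ℕ+) ≤ n := (le_max_right _ _).trans hn
      have : (2 : ℕ) ≤ n := this
      omega
    calc η ≤ ω ^ μ * (1 : ℕ) := by simpa using hημ.le
      _ ≤ ω ^ γ * ((n : ℕ) - 1 : ℕ) := by
        gcongr
        exact Ordinal.omega0_pos
      _ ≤ _ := le_self_add

/-- The last term of the Cantor normal form is split off, with exponent c; the induction passes to
the remainder after the leading term. -/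
theorem exists_eq_opow_mul_add_one {ξ : Ordinal.{0}} (hξ : ξ ≠ 0) :
    ∃ c γ : Ordinal.{0}, ξ = ω ^ c * (γ + 1) := by
  induction ξ using WellFoundedLT.induction with
  | ind ξ ih =>
  have hdecomp := Ordinal.div_add_mod ξ (ω ^ Ordinal.log ω ξ)
  by_cases hr : ξ % ω ^ Ordinal.log ω ξ = 0
  · obtain ⟨k, hk⟩ := Ordinal.lt_omega0.1 (Ordinal.div_opow_log_lt ξ Ordinal.one_lt_omega0)
    rw [hr, add_zero, hk] at hdecomp
    cases k with
    | zero => simp at hdecomp; exact absurd hdecomp.symm hξ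
    | succ k => exact ⟨Ordinal.log ω ξ, k, by rw [← Nat.cast_succ, hdecomp]⟩
  · obtain ⟨c, γ, hc⟩ := ih _ (Ordinal.mod_opow_log_lt_self ω hξ) hr
    have hlt : ξ % ω ^ Ordinal.log ω ξ < ω ^ Ordinal.log ω ξ :=
      Ordinal.mod_lt _ (Ordinal.opow_ne_zero _ Ordinal.omega0_ne_zero)
    have hcl : c < Ordinal.log ω ξ := by
      rw [← Ordinal.opow_lt_opow_iff_right Ordinal.one_lt_omega0]
      refine lt_of_le_of_lt ?_ hlt
      rw [hc]
      exact le_mul_of_one_le_right' le_add_self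
    obtain ⟨x, hx⟩ := exists_add_of_le hcl.le
    refine ⟨c, ω ^ x * (ξ / ω ^ Ordinal.log ω ξ) + γ, ?_⟩
    rw [add_assoc, mul_add, ← mul_assoc, ← Ordinal.opow_add, ← hx, ← hc, hdecomp]

/-- If the exponents differed, cancelling the smaller power would leave a successor divisible by ω.
-/
theorem opow_mul_add_one_inj {c c' γ γ' : Ordinal.{0}}
    (h : ω ^ c * (γ + 1) = ω ^ c' * (γ' + 1)) : c = c' ∧ γ = γ' := by
  have key : ∀ {c c' γ γ' : Ordinal.{0}}, ω ^ c * (γ + 1) = ω ^ c' * (γ' + 1) → ¬ c < c' := by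
    intro c c' γ γ' h hlt
    obtain ⟨x, rfl⟩ := exists_add_of_le hlt.le
    have hx : x ≠ 0 := by rintro rfl; simp at hlt
    rw [Ordinal.opow_add, mul_assoc] at h
    have h' := mul_left_cancel₀ (Ordinal.opow_ne_zero c Ordinal.omega0_ne_zero) h
    have hd : ω ∣ γ + 1 := by
      rw [h']
      refine Dvd.dvd.mul_right ?_ _
      simpa using Ordinal.opow_dvd_opow ω (Order.one_le_iff_pos.2 (pos_iff_ne_zero.2 hx))
    have := Ordinal.isSuccPrelimit_iff_omega0_dvd.2 hd
    rw [← Order.succ_eq_add_one] at this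
    exact Order.not_isSuccPrelimit_succ _ this
  have hcc : c = c' := le_antisymm (not_lt.1 (key h.symm)) (not_lt.1 (key h))
  subst hcc
  have hcancel := mul_left_cancel₀ (Ordinal.opow_ne_zero c Ordinal.omega0_ne_zero) h
  exact ⟨rfl, by simpa using hcancel⟩

/-- The fundamental sequence of `ξ ≠ 0`; for a successor it is constantly the predecessor. -/
noncomputable def fundSeq (ξ : Ordinal.{0}) (n : ℕ+) : Ordinal.{0} :=
  open Classical in
  if h : ξ ≠ 0 then
    ω ^ (exists_eq_opow_mul_add_one h).choose * (exists_eq_opow_mul_add_one h).choose_spec.choose +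
      powFS lam (exists_eq_opow_mul_add_one h).choose n
  else 0

theorem fundSeq_opow_mul_add_one (c γ : Ordinal.{0}) (n : ℕ+) :
    fundSeq lam (ω ^ c * (γ + 1)) n = ω ^ c * γ + powFS lam c n := by
  have h : ω ^ c * (γ + 1) ≠ 0 := by
    simp [Ordinal.opow_eq_zero]
  obtain ⟨h1, h2⟩ := opow_mul_add_one_inj (exists_eq_opow_mul_add_one h).choose_spec.choose_spec
  rw [fundSeq, dif_pos h, ← h2, ← h1]

theorem fundSeq_opow (c : Ordinal.{0}) (n : ℕ+) : fundSeq lam (ω ^ c) n = powFS lam c n := by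
  simpa using fundSeq_opow_mul_add_one lam c 0 n

theorem fundSeq_add_one (ζ : Ordinal.{0}) (n : ℕ+) : fundSeq lam (ζ + 1) n = ζ := by
  simpa [powFS_zero] using fundSeq_opow_mul_add_one lam 0 ζ n

theorem fundSeq_lt {ξ : Ordinal.{0}} (hξ : ξ ≠ 0) (n : ℕ+) : fundSeq lam ξ n < ξ := by
  obtain ⟨c, γ, rfl⟩ := exists_eq_opow_mul_add_one hξ
  rw [fundSeq_opow_mul_add_one, mul_add, mul_one]
  gcongr
  exact powFS_lt lam c n

/-- Only the last term of the normal form is changed by `fundSeq`, and under these hypotheses α + β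
has the same last exponent as β. -/
theorem fundSeq_add {α β c : Ordinal.{0}} (hβ0 : β ≠ 0) (hβ : β ≤ ω ^ c) (hα : ω ^ c ∣ α)
    (n : ℕ+) : fundSeq lam (α + β) n = α + fundSeq lam β n := by
  obtain ⟨b, γ, rfl⟩ := exists_eq_opow_mul_add_one hβ0
  have hbc : b ≤ c := by
    rw [← Ordinal.opow_le_opow_iff_right Ordinal.one_lt_omega0]
    exact (le_mul_of_one_le_right' le_add_self).trans hβ
  obtain ⟨δ, rfl⟩ := (Ordinal.opow_dvd_opow ω hbc).trans hα
  rw [← mul_add, ← add_assoc, fundSeq_opow_mul_add_one, fundSeq_opow_mul_add_one, mul_add,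
    add_assoc]

variable {lam} in
-- Derivatives see only late blocks, and a late block can leave a residual above any prescribed η <
-- ξ.
theorem eventually_le_fundSeq (hlam : IsFundamentalSystem lam) {ξ η : Ordinal.{0}}
    (hξ : ξ < ω_ 1) (hη : η < ξ) : ∃ N : ℕ+, ∀ n, N ≤ n → η ≤ fundSeq lam ξ n := by
  obtain ⟨c, γ, rfl⟩ := exists_eq_opow_mul_add_one (pos_of_gt hη).ne'
  have hc : c < ω_ 1 := by
    refine lt_of_le_of_lt ?_ hξ
    exact (Ordinal.right_le_opow c Ordinal.one_lt_omega0).trans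
      (le_mul_of_one_le_right' le_add_self)
  have hη' : η - ω ^ c * γ < ω ^ c := by
    refine Ordinal.sub_lt_of_lt_add ?_ (Ordinal.opow_pos _ Ordinal.omega0_pos)
    simpa [mul_add] using hη
  obtain ⟨N, hN⟩ := eventually_le_powFS hlam hc hη'
  refine ⟨N, fun n hn => ?_⟩
  rw [fundSeq_opow_mul_add_one]
  exact Ordinal.sub_le.1 (hN n hn)

end BlockSchreier

namespace BlockSchreier

/-! ### Walks along fundamental sequences and the Schreier families -/

/-- `Reach lam ξ A ρ`: starting from `ξ` and passing to `fundSeq lam · n` for the successive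
elements `n` of `A`, while the current ordinal is positive, one arrives at `ρ`. -/
inductive Reach (lam : Ordinal.{0} → ℕ+ → Ordinal.{0}) (ξ : Ordinal.{0}) :
    Finset ℕ+ → Ordinal.{0} → Prop
  | nil : Reach lam ξ ∅ ξ
  | snoc {A : Finset ℕ+} {ρ : Ordinal.{0}} {n : ℕ+} (h : Reach lam ξ A ρ) (hρ : ρ ≠ 0)
      (hn : ∀ x ∈ A, x < n) : Reach lam ξ (insert n A) (fundSeq lam ρ n)

theorem insert_eq_insert_of_lt {A B : Finset ℕ+} {n k : ℕ+} (hA : ∀ x ∈ A, x < n)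
    (hB : ∀ x ∈ B, x < k) (h : insert n A = insert k B) : n = k ∧ A = B := by
  have hnk : n = k := by
    have h1 : n ∈ insert k B := h ▸ Finset.mem_insert_self n A
    have h2 : k ∈ insert n A := h ▸ Finset.mem_insert_self k B
    rcases Finset.mem_insert.1 h1 with h1 | h1
    · exact h1
    · rcases Finset.mem_insert.1 h2 with h2 | h2
      · exact h2.symm
      · exact absurd (hA _ h2) (hB _ h1).asymm
  subst hnk
  refine ⟨rfl, ?_⟩
  rw [← Finset.erase_insert (fun hn => (hA n hn).false), h,
    Finset.erase_insert (fun hn => (hB n hn).false)]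

namespace Reach

variable {lam : Ordinal.{0} → ℕ+ → Ordinal.{0}} {ξ ρ : Ordinal.{0}} {A B : Finset ℕ+} {n : ℕ+}

theorem of_empty (h : Reach lam ξ ∅ ρ) : ρ = ξ := by
  generalize hE : (∅ : Finset ℕ+) = E at h
  cases h with
  | nil => rfl
  | snoc h _ _ => exact absurd hE.symm (Finset.insert_ne_empty _ _)

theorem last (h : Reach lam ξ (insert n A) ρ) (hA : ∀ x ∈ A, x < n) :
    ∃ σ, Reach lam ξ A σ ∧ σ ≠ 0 ∧ ρ = fundSeq lam σ n := by
  generalize hE : insert n A = E at h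
  cases h with
  | nil => exact absurd hE (Finset.insert_ne_empty _ _)
  | snoc h hρ hn =>
    obtain ⟨rfl, rfl⟩ := insert_eq_insert_of_lt hA hn hE
    exact ⟨_, h, hρ, rfl⟩

theorem unique {σ : Ordinal.{0}} (h : Reach lam ξ A ρ) (h' : Reach lam ξ A σ) : ρ = σ := by
  induction h generalizing σ with
  | nil => exact h'.of_empty.symm
  | snoc h _ hn ih =>
    obtain ⟨τ, hτ, _, rfl⟩ := h'.last hn
    rw [ih hτ]

theorem le (h : Reach lam ξ A ρ) : ρ ≤ ξ := by
  induction h with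
  | nil => exact le_rfl
  | snoc _ hρ _ ih => exact (fundSeq_lt lam hρ _).le.trans ih

theorem trans {σ : Ordinal.{0}} (h : Reach lam ξ A ρ) (h' : Reach lam ρ B σ)
    (hAB : BlockLT A B) : Reach lam ξ (A ∪ B) σ := by
  induction h' with
  | nil => simpa using h
  | @snoc B σ n h' hσ hn ih =>
    rw [Finset.union_insert]
    refine snoc (ih fun a ha b hb => hAB a ha b (Finset.mem_insert_of_mem hb)) hσ fun x hx => ?_
    rcases Finset.mem_union.1 hx with hx | hx
    · exact hAB x hx n (Finset.mem_insert_self _ _)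
    · exact hn x hx

theorem cons (hξ : ξ ≠ 0) (h : Reach lam (fundSeq lam ξ n) A ρ) (hn : ∀ x ∈ A, n < x) :
    Reach lam ξ (insert n A) ρ := by
  have h1 : Reach lam ξ {n} (fundSeq lam ξ n) := snoc (A := ∅) nil hξ (by simp)
  rw [Finset.insert_eq]
  exact h1.trans h (by simpa [BlockLT] using hn)

theorem first (h : Reach lam ξ (insert n A) ρ) (hn : ∀ x ∈ A, n < x) :
    ξ ≠ 0 ∧ Reach lam (fundSeq lam ξ n) A ρ := by
  induction A using Finset.induction_on_max generalizing ρ with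
  | empty =>
    obtain ⟨σ, h1, h2, rfl⟩ := h.last (by simp)
    rw [h1.of_empty] at h2 ⊢
    exact ⟨h2, nil⟩
  | insert k A hk ih =>
    rw [Finset.insert_comm] at h
    have hk' : ∀ x ∈ insert n A, x < k := by
      intro x hx
      rcases Finset.mem_insert.1 hx with rfl | hx
      · exact hn k (Finset.mem_insert_self _ _)
      · exact hk x hx
    obtain ⟨σ, h1, h2, rfl⟩ := h.last hk'
    obtain ⟨h3, h4⟩ := ih h1 fun x hx => hn x (Finset.mem_insert_of_mem hx)
    exact ⟨h3, snoc h4 h2 hk⟩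

theorem exists_first (h : Reach lam ξ A ρ) (hA : IsLeast (A : Set ℕ+) n) :
    ∃ B, A = insert n B ∧ (∀ x ∈ B, n < x) ∧ ξ ≠ 0 ∧ Reach lam (fundSeq lam ξ n) B ρ := by
  have h1 : A = insert n (A.erase n) := (Finset.insert_erase hA.1).symm
  have h2 : ∀ x ∈ A.erase n, n < x := fun x hx =>
    lt_of_le_of_ne (hA.2 (Finset.mem_of_mem_erase hx)) (Finset.ne_of_mem_erase hx).symm
  rw [h1] at h
  exact ⟨_, h1, h2, h.first h2⟩

/-- The walk consumes the right summand first, leaving the multiple α of ω^c untouched. -/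
theorem shift {α c : Ordinal.{0}} (h : Reach lam ξ A ρ) (hξ : ξ ≤ ω ^ c) (hα : ω ^ c ∣ α) :
    Reach lam (α + ξ) A (α + ρ) := by
  induction h with
  | nil => exact nil
  | @snoc A ρ n h hρ hn ih =>
    rw [← fundSeq_add lam hρ (h.le.trans hξ) hα]
    exact snoc ih (by simp [hρ]) hn

/-- Of two comparable sets in the same thin family, one is not a proper initial segment of the
other. -/
theorem eq_of_initial (hA : Reach lam ξ A 0) (hB : Reach lam ξ B ρ) (hAB : A ⊆ B)
    (hlt : ∀ x ∈ A, ∀ y ∈ B, y ∉ A → x < y) : A = B := by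
  induction hB with
  | nil => exact Finset.subset_empty.1 hAB
  | @snoc B ρ n h hρ hn ih =>
    -- If the last element of the longer walk lies in A, nothing of the walk is outside A. Otherwise
    -- A is contained in the walk without its last element, which would then have stopped at 0
    -- already.
    by_cases hnA : n ∈ A
    · refine Finset.Subset.antisymm hAB fun y hy => ?_
      by_contra hyA
      have h1 := hlt n hnA y hy hyA
      rcases Finset.mem_insert.1 hy with rfl | hy
      · exact h1.false
      · exact h1.asymm (hn y hy)
    · have hAB' : A ⊆ B := by
        intro x hx
        rcases Finset.mem_insert.1 (hAB hx) with rfl | h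
        · exact absurd hx hnA
        · exact h
      have := ih hAB' fun x hx y hy => hlt x hx y (Finset.mem_insert_of_mem hy)
      subst this
      exact absurd (h.unique hA) hρ

end Reach

/-! ### Members of the Schreier families are walks ending at 0. -/

variable {lam : Ordinal.{0} → ℕ+ → Ordinal.{0}}

theorem reach_opow_mul_natCast {β : Ordinal.{0}} {k : ℕ} (t : Fin k → Finset ℕ+)
    (hlt : ∀ i j, i < j → BlockLT (t i) (t j)) (ht : ∀ i, Reach lam (ω ^ β) (t i) 0) :
    Reach lam (ω ^ β * (k : Ordinal.{0})) (Finset.univ.biUnion t) 0 := by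
  induction k with
  | zero => simpa using Reach.nil
  | succ k ih =>
    have h1 := (ht 0).shift le_rfl (Dvd.intro (k : Ordinal.{0}) rfl)
    rw [add_zero, ← mul_add_one, ← Nat.cast_succ] at h1
    have h2 := ih (fun i => t i.succ) (fun i j hij => hlt _ _ (Fin.succ_lt_succ_iff.2 hij))
      fun i => ht _
    have h3 : Finset.univ.biUnion t = t 0 ∪ Finset.univ.biUnion fun i : Fin k => t i.succ := by
      ext x; simp [Fin.exists_fin_succ]
    rw [h3]
    refine h1.trans h2 fun a ha b hb => ?_
    obtain ⟨i, -, hi⟩ := Finset.mem_biUnion.1 hb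
    exact hlt 0 i.succ (Fin.succ_pos i) a ha b hi

/-- Reading the least element n of the first set leaves n - 1 copies of ω^β plus the residual of
that set. The number of sets is a separate `m` so that it can be split as `k + 1`. -/
theorem reach_opow_add_one {β : Ordinal.{0}} {n : ℕ+} {m : ℕ} (hm : (n : ℕ) = m)
    (hpos : 0 < m) (t : Fin m → Finset ℕ+)
    (hn : IsLeast (t ⟨0, hpos⟩ : Set ℕ+) n) (hlt : ∀ i j, i < j → BlockLT (t i) (t j))
    (ht : ∀ i, Reach lam (ω ^ β) (t i) 0) :
    Reach lam (ω ^ (β + 1)) (Finset.univ.biUnion t) 0 := by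
  have hpow := fundSeq_opow lam (β + 1) n
  rw [powFS_add_one, hm] at hpow
  cases m with
  | zero => exact absurd hpos (lt_irrefl 0)
  | succ k =>
    simp only [Nat.add_sub_cancel] at hpow
    have h2 := reach_opow_mul_natCast (fun i : Fin k => t i.succ)
      (fun i j hij => hlt _ _ (Fin.succ_lt_succ_iff.2 hij)) fun i => ht _
    obtain ⟨B, hB, hBn, -, hR⟩ := (ht ⟨0, hpos⟩).exists_first hn
    rw [fundSeq_opow] at hR
    have h1 := hR.shift (powFS_lt lam β n).le (Dvd.intro (k : Ordinal.{0}) rfl)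
    rw [add_zero, ← hpow] at h1
    have h3 : Finset.univ.biUnion t =
        insert n B ∪ Finset.univ.biUnion fun i : Fin k => t i.succ := by
      rw [← hB]; ext x; simp [Fin.exists_fin_succ]
    rw [h3]
    refine (Reach.cons (Ordinal.opow_ne_zero _ Ordinal.omega0_ne_zero) h1 hBn).trans h2
      fun a ha b hb => ?_
    obtain ⟨i, -, hi⟩ := Finset.mem_biUnion.1 hb
    exact hlt ⟨0, hpos⟩ i.succ (Fin.succ_pos i) a (hB ▸ ha) b hi

theorem sum_opow_lt {m : ℕ} (a : Fin m → Ordinal.{0}) (p : Fin m → ℕ) {e : Ordinal.{0}}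
    (he : ∀ i, a i < e) : (List.ofFn fun i => ω ^ a i * (p i : Ordinal.{0})).sum < ω ^ e := by
  induction m with
  | zero => simpa using Ordinal.opow_pos e Ordinal.omega0_pos
  | succ m ih =>
    rw [List.ofFn_succ, List.sum_cons]
    exact Ordinal.isPrincipal_add_omega0_opow e
      (Ordinal.opow_mul_lt_opow (Ordinal.natCast_lt_omega0 _) (he 0))
      (ih (fun i => a i.succ) (fun i => p i.succ) fun i => he _)

/-- The walk consumes the smallest exponents first, in agreement with the order of the sets. The
leading term is peeled off, and the walk through the rest is shifted by it. -/
theorem reach_sum {m : ℕ} (a : Fin m → Ordinal.{0}) (p : Fin m → ℕ)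
    (t : (i : Fin m) → Fin (p i) → Finset ℕ+) (ha : StrictAnti a)
    (hlt : ∀ i x y, x < y → BlockLT (t i x) (t i y))
    (hlt' : ∀ i j, i < j → ∀ x y, BlockLT (t j y) (t i x))
    (ht : ∀ i x, Reach lam (ω ^ a i) (t i x) 0) :
    Reach lam (List.ofFn fun i => ω ^ a i * (p i : Ordinal.{0})).sum
      (Finset.univ.biUnion fun i => Finset.univ.biUnion (t i)) 0 := by
  induction m with
  | zero => simpa using Reach.nil
  | succ m ih =>
    have h1 := ih (fun i => a i.succ) (fun i => p i.succ) (fun i => t i.succ)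
      (fun i j hij => ha (Fin.succ_lt_succ_iff.2 hij)) (fun i => hlt _)
      (fun i j hij => hlt' _ _ (Fin.succ_lt_succ_iff.2 hij)) fun i => ht _
    have h2 := reach_opow_mul_natCast (t 0) (hlt 0) (ht 0)
    have h3 := h1.shift (sum_opow_lt _ _ fun i => ha (Fin.succ_pos i)).le
      (Dvd.intro (p 0 : Ordinal.{0}) rfl)
    rw [add_zero] at h3
    have h4 : (Finset.univ.biUnion fun i => Finset.univ.biUnion (t i)) =
        (Finset.univ.biUnion fun i : Fin m => Finset.univ.biUnion (t i.succ)) ∪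
          Finset.univ.biUnion (t 0) := by
      ext x; simp [Fin.exists_fin_succ, or_comm]
    rw [List.ofFn_succ, List.sum_cons, h4]
    refine h3.trans h2 fun x hx y hy => ?_
    simp only [Finset.mem_biUnion, Finset.mem_univ, true_and] at hx hy
    obtain ⟨i, u, hx⟩ := hx
    obtain ⟨v, hy⟩ := hy
    exact hlt' 0 i.succ (Fin.succ_pos i) v u x hx y hy

theorem le_sum_of_mem {L : List Ordinal.{0}} {x : Ordinal.{0}} (hx : x ∈ L) : x ≤ L.sum := by
  induction L with
  | nil => simp at hx
  | cons y L ih =>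
    rw [List.sum_cons]
    rcases List.mem_cons.1 hx with rfl | hx
    · exact le_self_add
    · exact (ih hx).trans le_add_self

theorem Schreier.reach (hlam : IsFundamentalSystem lam) {ξ : Ordinal.{0}} {A : Finset ℕ+}
    (h : Schreier lam ξ A) (hξ : ξ < ω_ 1) : Reach lam ξ A 0 := by
  induction h with
  | zero => exact Reach.nil
  | succ ζ n s hn hs ih =>
    refine Reach.cons (by simp) ?_ (hn n (Finset.mem_singleton_self n))
    rw [fundSeq_add_one]
    exact ih ((lt_add_one ζ).trans hξ)
  | omega_succ β n t hn hlt ht ih =>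
    refine reach_opow_add_one rfl n.pos t hn hlt fun i => ih i (lt_trans ?_ hξ)
    exact (Ordinal.opow_lt_opow_iff_right Ordinal.one_lt_omega0).2 (lt_add_one β)
  | omega_limit l hl n s hn hs ih =>
    have hl' : l < ω_ 1 := (Ordinal.right_le_opow l Ordinal.one_lt_omega0).trans_lt hξ
    have hlt := ((hlam l hl hl').2.1 n).2
    have h1 := ih (lt_trans ((Ordinal.opow_lt_opow_iff_right Ordinal.one_lt_omega0).2 hlt) hξ)
    obtain ⟨B, rfl, hB, -, hR⟩ := h1.exists_first hn
    refine Reach.cons (Ordinal.opow_ne_zero _ Ordinal.omega0_ne_zero) ?_ hB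
    rwa [fundSeq_opow, powFS_limit lam hl hlt, ← fundSeq_opow]
  | sum m a p t ha ha0 hp hpm hlt hlt' ht ih =>
    refine reach_sum a p t ha hlt hlt' fun i x => ih i x (lt_of_le_of_lt ?_ hξ)
    refine le_trans ?_ (le_sum_of_mem (List.mem_ofFn.2 ⟨i, rfl⟩))
    exact le_mul_of_one_le_right' (by exact_mod_cast hp i)

end BlockSchreier

/-! ### Initial segments of infinite sets in the Schreier families. -/

namespace BlockSchreier

/-- `A` is a finite initial segment of `X`. -/
def InitSeg (A : Finset ℕ+) (X : Set ℕ+) : Prop :=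
  (A : Set ℕ+) ⊆ X ∧ ∀ x ∈ A, ∀ y ∈ X, y ∉ A → x < y

theorem InitSeg.union {A B : Finset ℕ+} {X : Set ℕ+} (hA : InitSeg A X)
    (hB : InitSeg B (X \ A)) : InitSeg (A ∪ B) X := by
  refine ⟨?_, fun x hx y hy hyn => ?_⟩
  · rw [Finset.coe_union]
    exact Set.union_subset hA.1 (hB.1.trans Set.sdiff_subset)
  · rw [Finset.mem_union, not_or] at hyn
    rcases Finset.mem_union.1 hx with hx | hx
    · exact hA.2 x hx y hy hyn.1
    · exact hB.2 x hx y ⟨hy, hyn.1⟩ hyn.2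

theorem InitSeg.isLeast {A : Finset ℕ+} {X : Set ℕ+} {n : ℕ+} (hA : InitSeg A X)
    (hne : A.Nonempty) (hn : IsLeast X n) : IsLeast (A : Set ℕ+) n := by
  refine ⟨?_, fun x hx => hn.2 (hA.1 hx)⟩
  obtain ⟨x, hx⟩ := hne
  by_contra h
  exact (hA.2 x hx n hn.1 h).not_ge (hn.2 (hA.1 hx))

theorem exists_isLeast {X : Set ℕ+} (hX : X.Nonempty) : ∃ n, IsLeast X n :=
  ⟨_, WellFounded.min_mem wellFounded_lt X hX, fun _ hx => WellFounded.min_le wellFounded_lt hx⟩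

/-- Greedy choice: each new set is an initial segment of what the earlier ones leave over. A general
finite linear order serves both `Fin n` and the lexicographic index of the sum clause. -/
theorem exists_initSeg_biUnion {ι : Type*} [LinearOrder ι] [Fintype ι]
    (P : ι → Finset ℕ+ → Prop) (hP : ∀ i, ∀ X : Set ℕ+, X.Infinite → ∃ A, InitSeg A X ∧ P i A)
    {X : Set ℕ+} (hX : X.Infinite) :
    ∃ t : ι → Finset ℕ+, (∀ i, P i (t i)) ∧ (∀ i j, i < j → BlockLT (t i) (t j)) ∧
      InitSeg (Finset.univ.biUnion t) X := by
  suffices h : ∀ S : Finset ι, ∃ t : ι → Finset ℕ+, (∀ i ∈ S, P i (t i)) ∧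
      (∀ i ∈ S, ∀ j ∈ S, i < j → BlockLT (t i) (t j)) ∧ InitSeg (S.biUnion t) X by
    simpa using h Finset.univ
  intro S
  induction S using Finset.induction_on_max with
  | empty => exact ⟨fun _ => ∅, by simp, by simp, by simp [InitSeg]⟩
  | insert j S hj ih =>
    obtain ⟨t, h1, h2, h3⟩ := ih
    obtain ⟨A, hA, hPA⟩ := hP j (X \ (S.biUnion t : Finset ℕ+))
      (hX.sdiff (Finset.finite_toSet _))
    have hne : ∀ i ∈ S, Function.update t j A i = t i := fun i hi =>
      Function.update_of_ne (hj i hi).ne _ _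
    refine ⟨Function.update t j A, ?_, ?_, ?_⟩
    · intro i hi
      rcases Finset.mem_insert.1 hi with rfl | hi
      · simpa using hPA
      · rw [hne i hi]; exact h1 i hi
    · intro i hi k hk hik
      rcases Finset.mem_insert.1 hi with rfl | hiS
      · rcases Finset.mem_insert.1 hk with rfl | hk
        · exact absurd hik (lt_irrefl _)
        · exact absurd hik (hj k hk).asymm
      · rw [hne i hiS]
        rcases Finset.mem_insert.1 hk with rfl | hk
        · rw [Function.update_self]
          intro a ha b hb
          have hb' := hA.1 hb
          exact h3.2 a (Finset.mem_biUnion.2 ⟨i, hiS, ha⟩) b hb'.1 hb'.2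
        · rw [hne k hk]; exact h2 i hiS k hk hik
    · rw [Finset.biUnion_insert, Function.update_self, Finset.biUnion_congr rfl hne,
        Finset.union_comm]
      exact h3.union hA

/-- Divisibility by ω rules out a finite last term, so all exponents are positive. The final clause
is what the induction needs in order to prepend a larger exponent. -/
theorem exists_normal_form {ξ : Ordinal.{0}} (hξ : ξ ≠ 0) (hω : ω ∣ ξ) :
    ∃ (m : ℕ) (a : Fin (m + 1) → Ordinal.{0}) (p : Fin (m + 1) → ℕ), StrictAnti a ∧
      (∀ i, 0 < a i) ∧ (∀ i, 1 ≤ p i) ∧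
      ξ = (List.ofFn fun i => ω ^ a i * (p i : Ordinal.{0})).sum ∧
      ∀ e, ξ < ω ^ e → ∀ i, a i < e := by
  induction ξ using WellFoundedLT.induction with
  | ind ξ ih =>
  have hdecomp := Ordinal.div_add_mod ξ (ω ^ Ordinal.log ω ξ)
  obtain ⟨k, hk⟩ := Ordinal.lt_omega0.1 (Ordinal.div_opow_log_lt ξ Ordinal.one_lt_omega0)
  have hle : ω ≤ ξ := Ordinal.le_of_dvd hξ hω
  have hlog : 0 < Ordinal.log ω ξ := Ordinal.log_pos Ordinal.one_lt_omega0 hξ hle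
  have hk1 : 1 ≤ k := by
    have := Ordinal.div_opow_log_pos ω hξ
    rw [hk] at this
    exact_mod_cast this
  have hloglt : ∀ e, ξ < ω ^ e → Ordinal.log ω ξ < e := fun e he =>
    (Ordinal.lt_opow_iff_log_lt Ordinal.one_lt_omega0 hξ).1 he
  rw [hk] at hdecomp
  by_cases hr : ξ % ω ^ Ordinal.log ω ξ = 0
  · refine ⟨0, fun _ => Ordinal.log ω ξ, fun _ => k, ?_, fun _ => hlog, fun _ => hk1, ?_,
      fun e he _ => hloglt e he⟩
    · intro i j hij
      have hi := i.2
      have hj := j.2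
      have hij' : (i : ℕ) < j := hij
      omega
    · simpa [hr] using hdecomp.symm
  · have hd : ω ∣ ω ^ Ordinal.log ω ξ * (k : Ordinal.{0}) := by
      refine Dvd.dvd.mul_right ?_ _
      simpa using Ordinal.opow_dvd_opow ω (Order.one_le_iff_pos.2 hlog)
    have hω' := hω
    rw [← hdecomp, Ordinal.dvd_add_iff hd] at hω'
    obtain ⟨m, a, p, ha, ha0, hp, hsum, hbd⟩ := ih _ (Ordinal.mod_opow_log_lt_self ω hξ) hr hω'
    have hlt := hbd _ (Ordinal.mod_lt ξ (Ordinal.opow_ne_zero (Ordinal.log ω ξ)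
      Ordinal.omega0_ne_zero))
    refine ⟨m + 1, Fin.cons (Ordinal.log ω ξ) a, Fin.cons k p, ?_, ?_, ?_, ?_, ?_⟩
    · intro i j hij
      cases j using Fin.cases with
      | zero => exact absurd hij (Fin.not_lt_zero i)
      | succ j =>
        cases i using Fin.cases with
        | zero => simpa using hlt j
        | succ i => simpa using ha (Fin.succ_lt_succ_iff.1 hij)
    · intro i; cases i using Fin.cases <;> simp [hlog, ha0]
    · intro i; cases i using Fin.cases <;> simp [hk1, hp]
    · rw [List.ofFn_succ, List.sum_cons]
      simp only [Fin.cons_zero, Fin.cons_succ]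
      rw [← hsum, hdecomp]
    · intro e he i
      cases i using Fin.cases with
      | zero => simpa using hloglt e he
      | succ i => simpa using (hlt i).trans (hloglt e he)

variable {lam : Ordinal.{0} → ℕ+ → Ordinal.{0}}

theorem exists_schreier_add_one {ζ : Ordinal.{0}}
    (h : ∀ X : Set ℕ+, X.Infinite → ∃ A, InitSeg A X ∧ Schreier lam ζ A)
    {X : Set ℕ+} (hX : X.Infinite) : ∃ A, InitSeg A X ∧ Schreier lam (ζ + 1) A := by
  obtain ⟨n, hn⟩ := exists_isLeast hX.nonempty
  obtain ⟨A, hA, hS⟩ := h (X \ ({n} : Finset ℕ+)) (hX.sdiff (Finset.finite_toSet _))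
  have hn1 : InitSeg {n} X := by
    refine ⟨by simpa using hn.1, fun x hx y hy hyn => ?_⟩
    rw [Finset.mem_singleton] at hx hyn
    rw [hx]
    exact lt_of_le_of_ne (hn.2 hy) (Ne.symm hyn)
  have h1 := hn1.union hA
  rw [← Finset.insert_eq] at h1
  refine ⟨_, h1, .succ ζ n A (fun x hx y hy => ?_) hS⟩
  have := hA.1 hy
  exact hn1.2 x hx y this.1 this.2

theorem exists_schreier_opow (hlam : IsFundamentalSystem lam) (c : Ordinal.{0}) (hc : c < ω_ 1)
    {X : Set ℕ+} (hX : X.Infinite) : ∃ A, InitSeg A X ∧ Schreier lam (ω ^ c) A := by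
  induction c using WellFoundedLT.induction generalizing X with
  | ind c ih =>
  have hne : ∀ {b A}, b < ω_ 1 → Schreier lam (ω ^ b) A → A.Nonempty := by
    intro b A hb hA
    rw [Finset.nonempty_iff_ne_empty]
    rintro rfl
    refine Ordinal.opow_ne_zero b Ordinal.omega0_ne_zero (hA.reach hlam ?_).of_empty.symm
    exact Ordinal.isPrincipal_opow_omega 1 Ordinal.omega0_lt_omega_one hb
  rcases Ordinal.zero_or_succ_or_isSuccLimit c with rfl | ⟨b, rfl⟩ | hl
  · have := exists_schreier_add_one (lam := lam) (ζ := 0)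
      (fun X _ => ⟨∅, by simp [InitSeg], .zero⟩) hX
    simpa using this
  · rw [Order.succ_eq_add_one] at *
    have hb := (lt_add_one b).trans hc
    obtain ⟨n, hn⟩ := exists_isLeast hX.nonempty
    obtain ⟨t, h1, h2, h3⟩ := exists_initSeg_biUnion (ι := Fin n)
      (fun _ => Schreier lam (ω ^ b)) (fun _ X hX => ih b (lt_add_one b) hb hX) hX
    refine ⟨_, h3, .omega_succ b n t ?_ h2 h1⟩
    have hle : ∀ i, ∀ x ∈ t i, n ≤ x := fun i x hx =>
      hn.2 (h3.1 (Finset.mem_biUnion.2 ⟨i, Finset.mem_univ _, hx⟩))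
    obtain ⟨x, hx⟩ := hne hb (h1 ⟨0, n.pos⟩)
    have hmem := (h3.isLeast ⟨x, Finset.mem_biUnion.2 ⟨_, Finset.mem_univ _, hx⟩⟩ hn).1
    obtain ⟨i, -, hi⟩ := Finset.mem_biUnion.1 (Finset.mem_coe.1 hmem)
    rcases eq_or_lt_of_le (Fin.mk_le_of_le_val (Nat.zero_le (i : ℕ)) : ⟨0, n.pos⟩ ≤ i)
      with h0 | h0
    · rw [h0]; exact ⟨hi, fun y hy => hle i y hy⟩
    · exact absurd (h2 _ _ h0 x hx n hi) (hle _ x hx).not_gt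
  · obtain ⟨n, hn⟩ := exists_isLeast hX.nonempty
    have hlt := ((hlam c hl hc).2.1 n).2
    obtain ⟨A, hA, hS⟩ := ih _ hlt (hlt.trans hc) hX
    exact ⟨A, hA, .omega_limit c hl n A (hA.isLeast (hne (hlt.trans hc) hS) hn) hS⟩

theorem exists_schreier (hlam : IsFundamentalSystem lam) (ξ : Ordinal.{0}) (hξ : ξ < ω_ 1)
    {X : Set ℕ+} (hX : X.Infinite) : ∃ A, InitSeg A X ∧ Schreier lam ξ A := by
  induction ξ using Ordinal.limitRecOn generalizing X with
  | zero => exact ⟨∅, by simp [InitSeg], .zero⟩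
  | add_one ζ ih =>
    exact exists_schreier_add_one (fun X hX => ih ((lt_add_one ζ).trans hξ) hX) hX
  | limit ξ hl _ =>
    obtain ⟨m, a, p, ha, ha0, hp, hsum, -⟩ := exists_normal_form hl.ne_bot
      (Ordinal.isSuccPrelimit_iff_omega0_dvd.1 hl.isSuccPrelimit)
    have hac : ∀ i, a i < ω_ 1 := by
      intro i
      refine lt_of_le_of_lt ?_ hξ
      rw [hsum]
      refine le_trans ?_ (le_sum_of_mem (List.mem_ofFn.2 ⟨i, rfl⟩))
      exact (Ordinal.right_le_opow _ Ordinal.one_lt_omega0).trans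
        (le_mul_of_one_le_right' (by exact_mod_cast hp i))
    by_cases hpm : 1 < p 0 ∨ 1 ≤ m
    -- The outer index carries the dual order because the sets for the smaller exponents lie further
    -- to the left.
    · obtain ⟨t, h1, h2, h3⟩ := exists_initSeg_biUnion
        (ι := Σₗ i : (Fin (m + 1))ᵒᵈ, Fin (p (OrderDual.ofDual i)))
        (fun q => Schreier lam (ω ^ a (OrderDual.ofDual (ofLex q).1)))
        (fun q X hX => exists_schreier_opow hlam _ (hac _) hX) hX
      have h4 := Schreier.sum (lam := lam) m a p
        (fun i x => t (toLex ⟨OrderDual.toDual i, x⟩)) ha ha0 hp hpm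
        (fun i x y hxy => h2 _ _ (Sigma.Lex.right _ _ hxy))
        (fun i j hij x y => h2 _ _ (Sigma.Lex.left _ _ (OrderDual.toDual_lt_toDual.2 hij)))
        (fun i x => h1 (toLex ⟨OrderDual.toDual i, x⟩))
      rw [← hsum] at h4
      refine ⟨_, ?_, h4⟩
      convert h3 using 1
      ext z
      simp only [Finset.mem_biUnion, Finset.mem_univ, true_and]
      constructor
      · rintro ⟨i, x, h⟩
        exact ⟨_, h⟩
      · rintro ⟨⟨i, x⟩, h⟩
        exact ⟨i, x, h⟩
    · have hm : m = 0 := by omega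
      subst hm
      have hp0 : p 0 = 1 := by have := hp 0; omega
      have : ξ = ω ^ a 0 := by simpa [hp0] using hsum
      rw [this]
      exact exists_schreier_opow hlam _ (hac 0) hX

/-- For the converse, A is prolonged by everything beyond its maximum, and the resulting infinite
set has an initial segment B in 𝓐_ξ. Both A and B are initial segments of it whose walks end at 0,
so thinness forces A = B. -/
theorem schreier_iff_reach (hlam : IsFundamentalSystem lam) {ξ : Ordinal.{0}} (hξ : ξ < ω_ 1)
    {A : Finset ℕ+} : Schreier lam ξ A ↔ Reach lam ξ A 0 := by
  refine ⟨fun h => h.reach hlam hξ, fun h => ?_⟩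
  obtain ⟨m, hm⟩ := A.bddAbove
  have hX : ((A : Set ℕ+) ∪ Set.Ioi m).Infinite := (Set.Ioi_infinite m).mono Set.subset_union_right
  obtain ⟨B, hB, hS⟩ := exists_schreier hlam ξ hξ hX
  have hR := hS.reach hlam hξ
  by_cases hBA : B ⊆ A
  · rwa [← hR.eq_of_initial h hBA fun x hx y hy hyn => hB.2 x hx y (Or.inl hy) hyn]
  · obtain ⟨z, hzB, hzA⟩ := Finset.not_subset.1 hBA
    have hmz : m < z := (hB.1 hzB).resolve_left hzA
    have hAB : A ⊆ B := by
      intro x hx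
      by_contra hxB
      exact (hB.2 z hzB x (Or.inl hx) hxB).asymm ((hm hx).trans_lt hmz)
    rwa [h.eq_of_initial hR hAB fun x hx y hy hyA =>
      (hm hx).trans_lt ((hB.1 hy).resolve_left hyA)]

/-- A finite set either can be continued to a member of the thin family, or has an initial segment
in it. -/
theorem reach_or_initial (ξ : Ordinal.{0}) (A : Finset ℕ+) :
    (∃ ρ, ρ ≠ 0 ∧ Reach lam ξ A ρ) ∨
      ∃ m : ℕ+, Reach lam ξ (A.filter (· < m)) 0 := by
  induction A using Finset.induction_on_max with
  | empty =>
    by_cases h : ξ = 0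
    · exact Or.inr ⟨1, by simpa [h] using Reach.nil⟩
    · exact Or.inl ⟨ξ, h, .nil⟩
  | insert n A hn ih =>
    have hfil : ∀ m, m ≤ n → (insert n A).filter (· < m) = A.filter (· < m) := by
      intro m hm
      rw [Finset.filter_insert, if_neg hm.not_gt]
    rcases ih with ⟨ρ, hρ, h⟩ | ⟨m, h⟩
    · by_cases h0 : fundSeq lam ρ n = 0
      · refine Or.inr ⟨n + 1, ?_⟩
        rw [Finset.filter_true_of_mem, ← h0]
        · exact h.snoc hρ hn
        · intro x hx
          rcases Finset.mem_insert.1 hx with rfl | hx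
          · exact PNat.lt_add_right x 1
          · exact (hn x hx).trans (PNat.lt_add_right n 1)
      · exact Or.inl ⟨_, h0, h.snoc hρ hn⟩
    · refine Or.inr ⟨min m n, ?_⟩
      rw [hfil _ (min_le_right _ _)]
      convert h using 1
      refine Finset.filter_congr fun x hx => ?_
      simp [hn x hx]

end BlockSchreier

namespace BlockSchreier

/-! ### Disjoint collections -/

theorem BlockLT.mono {s s' t t' : Finset ℕ+} (h : BlockLT s t) (hs : s' ⊆ s) (ht : t' ⊆ t) :
    BlockLT s' t' := fun a ha b hb => h a (hs ha) b (ht hb)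

theorem BlockLT.irrefl {s : Finset ℕ+} (hs : s.Nonempty) : ¬ BlockLT s s := fun h =>
  let ⟨x, hx⟩ := hs; (h x hx x hx).false

theorem BlockLT.asymm {s t : Finset ℕ+} (hs : s.Nonempty) (ht : t.Nonempty) (h : BlockLT s t) :
    ¬ BlockLT t s := fun h' =>
  let ⟨x, hx⟩ := hs; let ⟨y, hy⟩ := ht; (h x hx y hy).asymm (h' y hy x hx)

theorem blockLT_union {s s' t : Finset ℕ+} :
    BlockLT (s ∪ s') t ↔ BlockLT s t ∧ BlockLT s' t := by
  simp only [BlockLT, Finset.mem_union]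
  grind

/-- The union of the members of a finite collection. -/
def supp (s : Finset (Finset ℕ+)) : Finset ℕ+ := s.biUnion id

theorem subset_supp {s : Finset (Finset ℕ+)} {a : Finset ℕ+} (ha : a ∈ s) : a ⊆ supp s :=
  Finset.subset_biUnion_of_mem id ha

theorem blockLT_supp {s : Finset (Finset ℕ+)} {t : Finset ℕ+} :
    BlockLT (supp s) t ↔ ∀ a ∈ s, BlockLT a t := by
  simp only [BlockLT, supp, Finset.mem_biUnion, id]
  grind

/-- The least element of a nonempty finite set. -/
def minOf (a : Finset ℕ+) : ℕ+ := a.min.untopD 1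

theorem isLeast_minOf {a : Finset ℕ+} (ha : a.Nonempty) : IsLeast (a : Set ℕ+) (minOf a) := by
  have : minOf a = a.min' ha := by
    rw [minOf, ← Finset.coe_min' ha, WithTop.untopD_coe]
  rw [this]
  exact Finset.isLeast_min' a ha

theorem BlockLT.minOf_lt {a b : Finset ℕ+} (h : BlockLT a b) (ha : a.Nonempty)
    (hb : b.Nonempty) : minOf a < minOf b :=
  h _ (isLeast_minOf ha).1 _ (isLeast_minOf hb).1

/-- The set of the least elements of the members of a collection. -/
def mins (s : Finset (Finset ℕ+)) : Finset ℕ+ := s.image minOf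

theorem IsDisjointCollection.mono {S T : Set (Finset ℕ+)} (hT : IsDisjointCollection T)
    (h : S ⊆ T) : IsDisjointCollection S :=
  ⟨fun a ha => hT.1 a (h ha), hT.2.mono h⟩

theorem blockLT_of_minOf_le {S : Set (Finset ℕ+)} (hS : IsDisjointCollection S)
    {a b : Finset ℕ+} (ha : a ∈ S) (hb : b ∈ S) (hab : a ≠ b) (hle : minOf a ≤ minOf b) :
    BlockLT a b :=
  (hS.2 ha hb hab).resolve_right fun h => (h.minOf_lt (hS.1 b hb) (hS.1 a ha)).not_ge hle

theorem injOn_minOf {S : Set (Finset ℕ+)} (hS : IsDisjointCollection S) : S.InjOn minOf := by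
  intro a ha b hb hab
  by_contra hne
  exact ((blockLT_of_minOf_le hS ha hb hne hab.le).minOf_lt (hS.1 a ha) (hS.1 b hb)).ne hab

theorem empty_mem_finColl : ∅ ∈ finColl := by
  simp [finColl, IsDisjointCollection]

theorem mem_finColl_insert {s : Finset (Finset ℕ+)} {t : Finset ℕ+} (hs : s ∈ finColl)
    (ht : t.Nonempty) (hst : BlockLT (supp s) t) : insert t s ∈ finColl := by
  rw [blockLT_supp] at hst
  refine ⟨fun a ha => ?_, fun a ha b hb hab => ?_⟩
  · rcases Finset.mem_insert.1 (Finset.mem_coe.1 ha) with rfl | ha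
    · exact ht
    · exact hs.1 a ha
  · rcases Finset.mem_insert.1 (Finset.mem_coe.1 ha) with rfl | has <;>
      rcases Finset.mem_insert.1 (Finset.mem_coe.1 hb) with rfl | hbs
    · exact absurd rfl hab
    · exact Or.inr (hst b hbs)
    · exact Or.inl (hst a has)
    · exact hs.2 has hbs hab

theorem mins_insert (s : Finset (Finset ℕ+)) (t : Finset ℕ+) :
    mins (insert t s) = insert (minOf t) (mins s) := Finset.image_insert _ _ _

theorem mins_lt {s : Finset (Finset ℕ+)} {t : Finset ℕ+} (hs : s ∈ finColl) (ht : t.Nonempty)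
    (hst : BlockLT (supp s) t) : ∀ x ∈ mins s, x < minOf t := by
  intro x hx
  obtain ⟨a, ha, rfl⟩ := Finset.mem_image.1 hx
  exact (blockLT_supp.1 hst a ha).minOf_lt (hs.1 a ha) ht

theorem Reach.insert_block {lam : Ordinal.{0} → ℕ+ → Ordinal.{0}} {ξ ρ : Ordinal.{0}}
    {s : Finset (Finset ℕ+)} {t : Finset ℕ+} (h : Reach lam ξ (mins s) ρ) (hρ : ρ ≠ 0)
    (hs : s ∈ finColl) (ht : t.Nonempty) (hst : BlockLT (supp s) t) :
    Reach lam ξ (mins (insert t s)) (fundSeq lam ρ (minOf t)) := by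
  rw [mins_insert]
  exact h.snoc hρ (mins_lt hs ht hst)

theorem coe_mins {s : Finset (Finset ℕ+)} (hs : s ∈ finColl) :
    (mins s : Set ℕ+) = {m | ∃ a ∈ s, IsLeast (a : Set ℕ+) m} := by
  ext m
  simp only [mins, Finset.coe_image, Set.mem_image, Finset.mem_coe, Set.mem_ofPred_eq]
  refine exists_congr fun a => and_congr_right fun ha => ?_
  have h := isLeast_minOf (hs.1 a ha)
  exact ⟨fun e => e ▸ h, fun h' => h.unique h'⟩

theorem mem_blockSchreier_iff {lam : Ordinal.{0} → ℕ+ → Ordinal.{0}}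
    (hlam : IsFundamentalSystem lam) {ξ : Ordinal.{0}} (hξ : ξ < ω_ 1)
    {s : Finset (Finset ℕ+)} :
    s ∈ blockSchreier lam ξ ↔ s ∈ finColl ∧ Reach lam ξ (mins s) 0 := by
  refine and_congr_right fun hs => ?_
  rw [← coe_mins hs]
  simp only [Finset.coe_inj, exists_eq_right, schreier_iff_reach hlam hξ]

theorem subset_FU (S : Set (Finset ℕ+)) : S ⊆ FU S := fun a ha =>
  ⟨{a}, Finset.singleton_nonempty a, by simpa using ha, by simp⟩

theorem union_mem_FU {S : Set (Finset ℕ+)} {a b : Finset ℕ+} (ha : a ∈ FU S) (hb : b ∈ FU S) :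
    a ∪ b ∈ FU S := by
  obtain ⟨T, hT, hTS, rfl⟩ := ha
  obtain ⟨U, hU, hUS, rfl⟩ := hb
  refine ⟨T ∪ U, hT.mono Finset.subset_union_left, ?_, Finset.union_biUnion.symm⟩
  rw [Finset.coe_union]
  exact Set.union_subset hTS hUS

theorem FU_subset_FU {S S' : Set (Finset ℕ+)} (h : S ⊆ FU S') : FU S ⊆ FU S' := by
  rintro _ ⟨T, hT, hTS, rfl⟩
  induction hT using Finset.Nonempty.cons_induction with
  | singleton a => simpa using h (hTS (by simp))
  | cons a T ha hT ih =>
    rw [Finset.cons_eq_insert, Finset.biUnion_insert]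
    rw [Finset.coe_cons, Set.insert_subset_iff] at hTS
    exact union_mem_FU (h hTS.1) (ih hTS.2)

theorem FU_mono {S S' : Set (Finset ℕ+)} (h : S ⊆ S') : FU S ⊆ FU S' :=
  FU_subset_FU (h.trans (subset_FU S'))

theorem FU_empty : FU ∅ = ∅ := by
  ext u
  simp only [FU, Set.mem_ofPred_eq, Set.mem_empty_iff_false, iff_false]
  rintro ⟨T, hT, hTS, -⟩
  obtain ⟨x, hx⟩ := hT
  exact hTS hx

theorem nonempty_of_mem_FU {S : Set (Finset ℕ+)} (hS : ∀ a ∈ S, a.Nonempty) {u : Finset ℕ+}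
    (hu : u ∈ FU S) : u.Nonempty := by
  obtain ⟨T, ⟨a, ha⟩, hTS, rfl⟩ := hu
  exact (hS a (hTS ha)).mono (subset_supp ha)

theorem subset_supp_of_mem_FU {s : Finset (Finset ℕ+)} {u : Finset ℕ+}
    (hu : u ∈ FU (s : Set (Finset ℕ+))) : u ⊆ supp s := by
  obtain ⟨T, -, hTS, rfl⟩ := hu
  exact Finset.biUnion_subset_biUnion_of_subset_left _ (by exact_mod_cast hTS)

theorem supp_subset_supp {s t : Finset (Finset ℕ+)}
    (h : (t : Set (Finset ℕ+)) ⊆ FU (s : Set (Finset ℕ+))) : supp t ⊆ supp s :=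
  Finset.biUnion_subset.2 fun _ ha => subset_supp_of_mem_FU (h ha)

theorem finCollIn_mono {D D' : Set (Finset ℕ+)} (h : D ⊆ FU D') : finCollIn D ⊆ finCollIn D' :=
  fun _ hs => ⟨hs.1, hs.2.trans (FU_subset_FU h)⟩

theorem infCollIn_self {D : Set (Finset ℕ+)} (hD : D ∈ infColl) : D ∈ infCollIn D :=
  ⟨hD, subset_FU D⟩

theorem infCollIn_trans {D D₁ D₂ : Set (Finset ℕ+)} (h₁ : D₁ ∈ infCollIn D)
    (h₂ : D₂ ∈ infCollIn D₁) : D₂ ∈ infCollIn D :=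
  ⟨h₂.1, h₂.2.trans (FU_subset_FU h₁.2)⟩

theorem insert_mem_finCollIn {D : Set (Finset ℕ+)} (hD : D ∈ infColl)
    {s : Finset (Finset ℕ+)} {t : Finset ℕ+} (hs : s ∈ finCollIn D) (ht : t ∈ FU D)
    (hst : BlockLT (supp s) t) : insert t s ∈ finCollIn D := by
  refine ⟨mem_finColl_insert hs.1 (nonempty_of_mem_FU hD.2.1 ht) hst, ?_⟩
  rw [Finset.coe_insert]
  exact Set.insert_subset ht hs.2

theorem exists_first_block {s : Finset (Finset ℕ+)} (hs : s ∈ finColl) (hne : s.Nonempty) :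
    ∃ a r, s = insert a r ∧ a.Nonempty ∧ ∀ b ∈ r, BlockLT a b := by
  obtain ⟨a, ha, hmin⟩ := Finset.exists_min_image s minOf hne
  refine ⟨a, s.erase a, (Finset.insert_erase ha).symm, hs.1 a ha, fun b hb => ?_⟩
  have hbs := Finset.mem_of_mem_erase hb
  exact blockLT_of_minOf_le hs ha hbs (Finset.ne_of_mem_erase hb).symm (hmin b hbs)

theorem range_mem_infColl {f : ℕ → Finset ℕ+} (hne : ∀ n, (f n).Nonempty)
    (hf : ∀ m n, m < n → BlockLT (f m) (f n)) : Set.range f ∈ infColl := by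
  refine ⟨Set.infinite_range_of_injective fun m n hmn => ?_, ?_, ?_⟩
  · by_contra h
    rcases Ne.lt_or_gt h with h | h
    · exact BlockLT.irrefl (hne n) (by simpa [hmn] using hf m n h)
    · exact BlockLT.irrefl (hne n) (by simpa [hmn] using hf n m h)
  · rintro _ ⟨n, rfl⟩; exact hne n
  · rintro _ ⟨m, rfl⟩ _ ⟨n, rfl⟩ h
    rcases lt_trichotomy m n with hmn | rfl | hmn
    · exact Or.inl (hf m n hmn)
    · exact absurd rfl h
    · exact Or.inr (hf n m hmn)

theorem exists_blockLT_seq {S : Set (Finset ℕ+)} (h : ∀ a, ∃ d ∈ S, BlockLT a d) :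
    ∃ f : ℕ → Finset ℕ+, (∀ n, f n ∈ S) ∧ ∀ m n, m < n → BlockLT (f m) (f n) := by
  refine exists_seq_of_forall_finset_exists (· ∈ S) BlockLT fun s _ => ?_
  obtain ⟨d, hd, hsd⟩ := h (supp s)
  exact ⟨d, hd, blockLT_supp.1 hsd⟩

theorem exists_infColl_subset {S : Set (Finset ℕ+)} (hne : ∀ a ∈ S, a.Nonempty)
    (h : ∀ a, ∃ d ∈ S, BlockLT a d) : ∃ E ∈ infColl, E ⊆ S := by
  obtain ⟨f, hfS, hf⟩ := exists_blockLT_seq h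
  exact ⟨_, range_mem_infColl (fun n => hne _ (hfS n)) hf, Set.range_subset_iff.2 hfS⟩

/-- The members of `D` lying after the finite set `a`. -/
def after (D : Set (Finset ℕ+)) (a : Finset ℕ+) : Set (Finset ℕ+) := {d | d ∈ D ∧ BlockLT a d}

theorem exists_blockLT {D : Set (Finset ℕ+)} (hD : D ∈ infColl) (a : Finset ℕ+) :
    ∃ d ∈ D, BlockLT a d := by
  obtain ⟨m, hm⟩ := a.bddAbove
  obtain ⟨_, ⟨d, hd, rfl⟩, hmd⟩ := (hD.1.image (injOn_minOf hD.2)).exists_gt m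
  exact ⟨d, hd, fun x hx y hy =>
    ((hm hx).trans_lt hmd).trans_le ((isLeast_minOf (hD.2.1 d hd)).2 hy)⟩

theorem after_mem_infCollIn {D : Set (Finset ℕ+)} (hD : D ∈ infColl) (a : Finset ℕ+) :
    after D a ∈ infCollIn D := by
  refine ⟨⟨fun hfin => ?_, hD.2.mono fun d hd => hd.1⟩, fun d hd => subset_FU D hd.1⟩
  obtain ⟨d, hd, had⟩ := exists_blockLT hD (a ∪ supp hfin.toFinset)
  rw [blockLT_union] at had
  have hmem : d ∈ hfin.toFinset := hfin.mem_toFinset.2 ⟨hd, had.1⟩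
  exact BlockLT.irrefl (hD.2.1 d hd) (had.2.mono (subset_supp hmem) Finset.Subset.rfl)

theorem mem_FU_after {D : Set (Finset ℕ+)} {a t : Finset ℕ+} (ht : t ∈ FU D)
    (hat : BlockLT a t) : t ∈ FU (after D a) := by
  obtain ⟨T, hT, hTD, rfl⟩ := ht
  exact ⟨T, hT, fun d hd => ⟨hTD hd, hat.mono Finset.Subset.rfl (subset_supp hd)⟩, rfl⟩

theorem blockLT_of_mem_FU_after {D : Set (Finset ℕ+)} {a t : Finset ℕ+}
    (ht : t ∈ FU (after D a)) : BlockLT a t := by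
  obtain ⟨T, hT, hTD, rfl⟩ := ht
  intro x hx y hy
  obtain ⟨d, hd, hyd⟩ := Finset.mem_biUnion.1 hy
  exact (hTD hd).2 x hx y hyd

/-! ### Hindman's theorem and fusion -/

/-- Finite sets are coded as multisets so that an addition is available for Hindman's theorem; for
successive blocks the sum is the union. -/
theorem exists_mem_FU_of_mem_FS {a : Stream' (Multiset ℕ+)} {m : Multiset ℕ+}
    (hm : m ∈ Hindman.FS a) {f : ℕ → Finset ℕ+} (hf : ∀ i j, i < j → BlockLT (f i) (f j))
    (ha : ∀ n, a.get n = (f n).val) : ∃ u ∈ FU (Set.range f), m = u.val := by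
  induction hm generalizing f with
  | head' a => exact ⟨f 0, subset_FU _ (Set.mem_range_self 0), ha 0⟩
  | tail' a m h ih =>
    obtain ⟨u, hu, rfl⟩ := ih (f := fun n => f (n + 1))
      (fun i j hij => hf _ _ (Nat.succ_lt_succ hij)) fun n => ha (n + 1)
    exact ⟨u, FU_mono (Set.range_comp_subset_range (· + 1) f) hu, rfl⟩
  | cons' a m h ih =>
    obtain ⟨u, hu, rfl⟩ := ih (f := fun n => f (n + 1))
      (fun i j hij => hf _ _ (Nat.succ_lt_succ hij)) fun n => ha (n + 1)
    have hlt : BlockLT (f 0) u := by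
      obtain ⟨T, -, hT, rfl⟩ := hu
      intro x hx y hy
      obtain ⟨d, hd, hyd⟩ := Finset.mem_biUnion.1 hy
      obtain ⟨n, rfl⟩ := hT hd
      exact hf 0 (n + 1) n.succ_pos x hx y hyd
    have hdisj : Disjoint (f 0) u :=
      Finset.disjoint_left.2 fun x hx hxu => (hlt x hx x hxu).false
    refine ⟨f 0 ∪ u, union_mem_FU (subset_FU _ (Set.mem_range_self 0))
      (FU_mono (Set.range_comp_subset_range (· + 1) f) hu), ?_⟩
    rw [← Finset.disjUnion_eq_union _ _ hdisj, Finset.disjUnion_val]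
    exact congrArg (· + u.val) (ha 0)

/-- **Hindman's theorem** for finite unions. -/
theorem exists_infCollIn_monochromatic {D : Set (Finset ℕ+)} (hD : D ∈ infColl)
    (C : Set (Finset ℕ+)) : ∃ D₁ ∈ infCollIn D, FU D₁ ⊆ C ∨ FU D₁ ⊆ Cᶜ := by
  obtain ⟨f, hfD, hf⟩ := exists_blockLT_seq (exists_blockLT hD)
  set a : Stream' (Multiset ℕ+) := fun n => (f n).val with ha
  have hFS : ∀ m ∈ Hindman.FS a, m.Nodup ∧ m.toFinset ∈ FU D := by
    intro m hm
    obtain ⟨u, hu, rfl⟩ := exists_mem_FU_of_mem_FS hm hf fun n => rfl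
    exact ⟨u.nodup, by simpa using FU_mono (Set.range_subset_iff.2 hfD) hu⟩
  set X : Set (Multiset ℕ+) := {m | m.toFinset ∈ C} with hX
  obtain ⟨c, hc, b, hb⟩ := Hindman.FS_partition_regular a
    {Hindman.FS a ∩ X, Hindman.FS a ∩ Xᶜ} (by simp) (by
      rw [Set.sUnion_pair, ← Set.inter_union_distrib_left, Set.union_compl_self, Set.inter_univ])
  have hbFS : ∀ m ∈ Hindman.FS b, m.Nodup ∧ m.toFinset ∈ FU D := by
    intro m hm
    rcases hc with rfl | rfl
    · exact hFS m (hb hm).1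
    · exact hFS m (hb hm).1
  -- Sums of two terms of `b` have no repetitions, so the terms are pairwise disjoint. Only finitely
  -- many can then meet a bounded set, and a block subsequence can be extracted.
  have hdisj : ∀ i j, i < j → Disjoint (b.get i) (b.get j) := fun i j hij =>
    (Multiset.nodup_add.1 (hbFS _ (Hindman.FS.add_two b i j hij)).1).2.2
  have hmem : ∀ i, (b.get i).toFinset ∈ FU D := fun i => (hbFS _ (Hindman.FS.singleton b i)).2
  have hunb : ∀ e, ∃ d ∈ Set.range fun i => (b.get i).toFinset, BlockLT e d := by
    intro e
    by_contra! hcon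
    have h1 : ∀ i, ∃ x ∈ b.get i, ∃ y ∈ e, x ≤ y := by
      intro i
      have := hcon _ ⟨i, rfl⟩
      simp only [BlockLT] at this
      push Not at this
      obtain ⟨y, hy, x, hx, hxy⟩ := this
      exact ⟨x, by simpa using hx, y, hy, hxy⟩
    choose x hx y hy hxy using h1
    obtain ⟨m, hm⟩ := e.bddAbove
    have hinj : Function.Injective x := by
      intro i j hij
      by_contra hne
      rcases Ne.lt_or_gt hne with h | h
      · exact Multiset.disjoint_left.1 (hdisj i j h) (hx i) (hij ▸ hx j)
      · exact Multiset.disjoint_left.1 (hdisj j i h) (hx j) (hij ▸ hx i)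
    refine Set.infinite_range_of_injective hinj ((Set.finite_Iic m).subset ?_)
    rintro _ ⟨i, rfl⟩
    exact (hxy i).trans (hm (hy i))
  obtain ⟨E, hE, hEb⟩ := exists_infColl_subset (fun d hd => by
    obtain ⟨i, rfl⟩ := hd
    exact nonempty_of_mem_FU hD.2.1 (hmem i)) hunb
  have hFU : ∀ u ∈ FU E, ∃ m ∈ Hindman.FS b, m.toFinset = u := by
    rintro _ ⟨T, hT, hTE, rfl⟩
    obtain ⟨I, rfl⟩ : ∃ I : Finset ℕ, T = I.image fun i => (b.get i).toFinset := by
      have : (T : Set (Finset ℕ+)) ⊆ (fun i => (b.get i).toFinset) '' Set.univ := by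
        rw [Set.image_univ]; exact hTE.trans hEb
      obtain ⟨I, -, hI⟩ := Finset.subset_set_image_iff.1 this
      exact ⟨I, hI.symm⟩
    refine ⟨_, Hindman.FS.finsetSum b I (by simpa using hT), ?_⟩
    ext x
    simp [Multiset.mem_sum]
  refine ⟨E, ⟨hE, fun d hd => ?_⟩, ?_⟩
  · obtain ⟨i, rfl⟩ := hEb hd
    exact hmem i
  · rcases hc with rfl | rfl
    · refine Or.inl fun u hu => ?_
      obtain ⟨m, hm, rfl⟩ := hFU u hu
      exact (hb hm).2
    · refine Or.inr fun u hu => ?_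
      obtain ⟨m, hm, rfl⟩ := hFU u hu
      exact (hb hm).2

/-- A property that is inherited by smaller collections and can always be reached by passing to
a smaller collection holds for all tails of a suitable collection. -/
theorem exists_infCollIn_fusion (P : Finset ℕ+ → Set (Finset ℕ+) → Prop)
    (hmono : ∀ a E E', E' ⊆ FU E → P a E → P a E')
    (hex : ∀ a, ∀ E ∈ infColl, ∃ E' ∈ infCollIn E, P a E')
    {D : Set (Finset ℕ+)} (hD : D ∈ infColl) :
    ∃ D₁ ∈ infCollIn D, ∀ a ∈ FU D₁, P a (after D₁ a) := by
  have hfin : ∀ S : Finset (Finset ℕ+), ∀ E ∈ infColl, ∃ E' ∈ infCollIn E, ∀ a ∈ S, P a E' := by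
    intro S
    induction S using Finset.induction_on with
    | empty => exact fun E hE => ⟨E, infCollIn_self hE, by simp⟩
    | insert a S _ ih =>
      intro E hE
      obtain ⟨E₁, hE₁, h1⟩ := ih E hE
      obtain ⟨E₂, hE₂, h2⟩ := hex a E₁ hE₁.1
      refine ⟨E₂, infCollIn_trans hE₁ hE₂, fun b hb => ?_⟩
      rcases Finset.mem_insert.1 hb with rfl | hb
      · exact h2
      · exact hmono _ _ _ hE₂.2 (h1 b hb)
  -- The property is secured at once for all finitely many sets bounded by an element of the new
  -- block; these include every union of blocks chosen so far.
  have hstep : ∀ E : {E // E ∈ infColl}, ∃ (a : Finset ℕ+) (E' : {E // E ∈ infColl}),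
      a ∈ E.1 ∧ E'.1 ⊆ FU (after E.1 a) ∧ ∀ b, (∀ x ∈ b, ∃ y ∈ a, x ≤ y) → P b E'.1 := by
    intro E
    obtain ⟨a, ha⟩ := E.2.1.nonempty
    obtain ⟨E', hE', h⟩ := hfin (a.biUnion Finset.Iic).powerset _ (after_mem_infCollIn E.2 a).1
    refine ⟨a, ⟨E', hE'.1⟩, ha, hE'.2, fun b hb => h b ?_⟩
    rw [Finset.mem_powerset]
    intro x hx
    obtain ⟨y, hy, hxy⟩ := hb x hx
    exact Finset.mem_biUnion.2 ⟨y, hy, Finset.mem_Iic.2 hxy⟩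
  choose a next ha hnext hP using hstep
  let E : ℕ → {E // E ∈ infColl} := fun n => next^[n] ⟨D, hD⟩
  have hE : ∀ n, E (n + 1) = next (E n) := fun n => Function.iterate_succ_apply' _ _ _
  have hEle : ∀ m n, m ≤ n → (E n).1 ⊆ FU (E m).1 := by
    intro m n hmn
    induction n, hmn using Nat.le_induction with
    | base => exact subset_FU _
    | succ n _ ih =>
      rw [hE]
      exact ((hnext _).trans (FU_mono fun d hd => hd.1)).trans (FU_subset_FU ih)
  have hmem : ∀ m n, m < n → a (E n) ∈ FU (E (m + 1)).1 := fun m n hmn => hEle _ _ hmn (ha _)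
  have hlt : ∀ m n, m < n → BlockLT (a (E m)) (a (E n)) := by
    intro m n hmn
    have := hmem m n hmn
    rw [hE] at this
    exact blockLT_of_mem_FU_after (FU_subset_FU (hnext _) this)
  refine ⟨Set.range fun n => a (E n), ⟨range_mem_infColl (fun n => (E n).2.2.1 _ (ha _)) hlt, ?_⟩,
    ?_⟩
  · rintro _ ⟨n, rfl⟩
    exact hEle 0 n (Nat.zero_le n) (ha _)
  · rintro _ ⟨T, hT, hTr, rfl⟩
    obtain ⟨I, rfl⟩ : ∃ I : Finset ℕ, T = I.image fun i => a (E i) := by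
      rw [← Set.image_univ] at hTr
      obtain ⟨I, -, hI⟩ := Finset.subset_set_image_iff.1 hTr
      exact ⟨I, hI.symm⟩
    -- With `k` the last index used in the union, every chosen block behind the union lies in `FU`
    -- of stage k + 1, where the property is already secured.
    obtain ⟨k, hk, hmax⟩ := Finset.exists_max_image I id (by simpa using hT)
    refine hmono _ (E (k + 1)).1 _ ?_ ?_
    · rintro _ ⟨⟨n, rfl⟩, hn⟩
      refine hmem k n ?_
      by_contra hnk
      have h1 := hn.mono (subset_supp (Finset.mem_image_of_mem (fun i => a (E i)) hk))
        Finset.Subset.rfl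
      have hne : ∀ n, (a (E n)).Nonempty := fun n => (E n).2.2.1 _ (ha _)
      rcases eq_or_lt_of_le (not_lt.1 hnk) with rfl | h2
      · exact BlockLT.irrefl (hne _) h1
      · exact BlockLT.asymm (hne _) (hne _) (hlt _ _ h2) h1
    · rw [hE]
      refine hP _ _ fun x hx => ?_
      obtain ⟨d, hd, hxd⟩ := Finset.mem_biUnion.1 hx
      obtain ⟨i, hi, rfl⟩ := Finset.mem_image.1 hd
      rcases eq_or_lt_of_le (hmax i hi) with h | h
      · simp only [id] at h
        subst h
        exact ⟨x, hxd, le_rfl⟩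
      · obtain ⟨y, hy⟩ := (E k).2.2.1 _ (ha (E k))
        exact ⟨y, hy, (hlt _ _ h x hxd y hy).le⟩

end BlockSchreier

namespace BlockSchreier

/-! ### The dichotomy for the families `𝓑^ξ` -/

theorem Reach.exists_first_block {lam : Ordinal.{0} → ℕ+ → Ordinal.{0}} {ξ ρ : Ordinal.{0}}
    {s : Finset (Finset ℕ+)} (h : Reach lam ξ (mins s) ρ) (hs : s ∈ finColl)
    (hne : s.Nonempty) :
    ∃ a r, s = insert a r ∧ a.Nonempty ∧ (∀ b ∈ r, BlockLT a b) ∧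
      Reach lam (fundSeq lam ξ (minOf a)) (mins r) ρ := by
  obtain ⟨a, r, rfl, ha, hr⟩ := BlockSchreier.exists_first_block hs hne
  refine ⟨a, r, rfl, ha, hr, ?_⟩
  rw [mins_insert] at h
  refine (h.first fun x hx => ?_).2
  obtain ⟨b, hb, rfl⟩ := Finset.mem_image.1 hx
  exact (hr b hb).minOf_lt ha (hs.1 b (Finset.mem_insert_of_mem hb))

/-- Every family of finite collections is homogeneous for `𝓑^ξ` on some infinite disjoint
collection. -/
theorem exists_homogeneous (lam : Ordinal.{0} → ℕ+ → Ordinal.{0}) (ξ : Ordinal.{0})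
    (F : Set (Finset (Finset ℕ+))) {D : Set (Finset ℕ+)} (hD : D ∈ infColl) :
    ∃ D₁ ∈ infCollIn D, (∀ s ∈ finCollIn D₁, Reach lam ξ (mins s) 0 → s ∈ F) ∨
      ∀ s ∈ finCollIn D₁, Reach lam ξ (mins s) 0 → s ∉ F := by
  induction ξ using WellFoundedLT.induction generalizing F D with
  | ind ξ ih =>
  by_cases hξ : ξ = 0
  · have hempty : ∀ s, Reach lam ξ (mins s) 0 → s = ∅ := by
      intro s h
      rw [hξ] at h
      by_contra hne
      obtain ⟨n, hn⟩ := exists_isLeast (X := (mins s : Set ℕ+)) (by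
        simpa [mins, Finset.nonempty_iff_ne_empty] using hne)
      obtain ⟨_, _, _, h0, _⟩ := h.exists_first hn
      exact h0 rfl
    refine ⟨D, infCollIn_self hD, ?_⟩
    by_cases hF : ∅ ∈ F
    · exact Or.inl fun s _ h => hempty s h ▸ hF
    · exact Or.inr fun s _ h => hempty s h ▸ hF
  -- `Q` and `R` are the two outcomes of the induction hypothesis for the remainder behind a first
  -- block `a`. Fusion provides one of them for every `a`; Hindman's theorem, with `a` coloured by
  -- whether `Q` holds, makes the outcome uniform.
  · let Q : Finset ℕ+ → Set (Finset ℕ+) → Prop := fun a E => ∀ s ∈ finCollIn E,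
      Reach lam (fundSeq lam ξ (minOf a)) (mins s) 0 → insert a s ∈ F
    let R : Finset ℕ+ → Set (Finset ℕ+) → Prop := fun a E => ∀ s ∈ finCollIn E,
      Reach lam (fundSeq lam ξ (minOf a)) (mins s) 0 → insert a s ∉ F
    have hQ : ∀ a E E', E' ⊆ FU E → Q a E → Q a E' :=
      fun a E E' h hq s hs => hq s (finCollIn_mono h hs)
    have hR : ∀ a E E', E' ⊆ FU E → R a E → R a E' :=
      fun a E E' h hq s hs => hq s (finCollIn_mono h hs)
    obtain ⟨D₁, hD₁, hP⟩ := exists_infCollIn_fusion (fun a E => Q a E ∨ R a E)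
      (fun a E E' h => Or.imp (hQ a E E' h) (hR a E E' h))
      (fun a E hE => ih _ (fundSeq_lt lam hξ _) {s | insert a s ∈ F} hE) hD
    obtain ⟨D₂, hD₂, hC⟩ := exists_infCollIn_monochromatic hD₁.1 {a | Q a (after D₁ a)}
    have hdec : ∀ s ∈ finCollIn D₂, Reach lam ξ (mins s) 0 → ∃ a ∈ FU D₂, ∃ r,
        s = insert a r ∧ r ∈ finCollIn (after D₁ a) ∧
          Reach lam (fundSeq lam ξ (minOf a)) (mins r) 0 := by
      intro s hs h
      have hne : s.Nonempty := by
        rw [Finset.nonempty_iff_ne_empty]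
        rintro rfl
        exact hξ (h.of_empty).symm
      obtain ⟨a, r, rfl, ha, hr, h'⟩ := h.exists_first_block hs.1 hne
      refine ⟨a, hs.2 (by simp), r, rfl, ⟨hs.1.mono (by simp), fun b hb => ?_⟩, h'⟩
      exact mem_FU_after (FU_subset_FU hD₂.2 (hs.2 (by simpa using Or.inr hb))) (hr b hb)
    refine ⟨D₂, infCollIn_trans hD₁ hD₂, ?_⟩
    rcases hC with hC | hC
    · refine Or.inl fun s hs h => ?_
      obtain ⟨a, ha, r, rfl, hr, h'⟩ := hdec s hs h
      exact hC ha r hr h'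
    · refine Or.inr fun s hs h => ?_
      obtain ⟨a, ha, r, rfl, hr, h'⟩ := hdec s hs h
      exact (hP a (FU_subset_FU hD₂.2 ha)).resolve_left (hC ha) r hr h'

theorem IsInitial.mem_finCollIn {D : Set (Finset ℕ+)} {s t : Finset (Finset ℕ+)}
    (h : IsInitial t s) (hs : s ∈ finCollIn D) : t ∈ finCollIn D :=
  ⟨hs.1.mono (Finset.coe_subset.2 h.1), (Finset.coe_subset.2 h.1).trans hs.2⟩

theorem reach_or_isInitial (lam : Ordinal.{0} → ℕ+ → Ordinal.{0}) (ξ : Ordinal.{0})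
    {s : Finset (Finset ℕ+)} (hs : s ∈ finColl) :
    (∃ ρ, ρ ≠ 0 ∧ Reach lam ξ (mins s) ρ) ∨
      ∃ t, IsInitial t s ∧ Reach lam ξ (mins t) 0 := by
  refine (reach_or_initial (lam := lam) ξ (mins s)).imp_right ?_
  rintro ⟨m, hm⟩
  refine ⟨s.filter (minOf · < m), ⟨Finset.filter_subset _ _, fun a ha b hb hbt => ?_⟩, ?_⟩
  · rw [Finset.mem_filter] at ha
    rw [Finset.mem_filter, not_and, not_lt] at hbt
    have hlt := ha.2.trans_le (hbt hb)
    exact blockLT_of_minOf_le hs ha.1 hb (by rintro rfl; exact hlt.false) hlt.le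
  · rw [mins, Finset.filter_image] at hm
    exact hm

/-- Each appended block strictly lowers the residual, so appending must stop at 0. -/
theorem Reach.exists_extension {lam : Ordinal.{0} → ℕ+ → Ordinal.{0}} {ξ ρ : Ordinal.{0}}
    {D : Set (Finset ℕ+)} (hD : D ∈ infColl) {s : Finset (Finset ℕ+)}
    (h : Reach lam ξ (mins s) ρ) (hs : s ∈ finCollIn D) :
    ∃ u ∈ finCollIn D, IsInitial s u ∧ Reach lam ξ (mins u) 0 := by
  induction ρ using WellFoundedLT.induction generalizing s with
  | ind ρ ih =>
  by_cases hρ : ρ = 0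
  · exact ⟨s, hs, ⟨Finset.Subset.rfl, fun a _ b hb hbs => absurd hb hbs⟩, hρ ▸ h⟩
  · obtain ⟨t, ht, hst⟩ := exists_blockLT hD (supp s)
    obtain ⟨u, hu, hsu, hR⟩ := ih _ (fundSeq_lt lam hρ _)
      (h.insert_block hρ hs.1 (hD.2.1 t ht) hst)
      (insert_mem_finCollIn hD hs (subset_FU D ht) hst)
    refine ⟨u, hu, ⟨(Finset.subset_insert t s).trans hsu.1, fun a ha b hb hbs => ?_⟩, hR⟩
    by_cases hbt : b = t
    · rw [hbt]; exact blockLT_supp.1 hst a ha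
    · exact hsu.2 a (Finset.mem_insert_of_mem ha) b hb (by simp [hbt, hbs])

/-! ### Hereditary families -/

/-- Every finite collection contained in `FU s` belongs to `G` whenever `s` does. -/
def IsHereditary (G : Set (Finset (Finset ℕ+))) : Prop :=
  ∀ s ∈ G, ∀ t ∈ finColl, (t : Set (Finset ℕ+)) ⊆ FU (s : Set (Finset ℕ+)) → t ∈ G

theorem isHereditary_hereditaryPart (F : Set (Finset (Finset ℕ+))) :
    IsHereditary (hereditaryPart F) := by
  rintro s (⟨_, h⟩ | rfl) t ht hts
  · exact Or.inl ⟨h t ht hts, fun u hu hut => h u hu (hut.trans (FU_subset_FU hts))⟩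
  · rw [Finset.coe_empty, FU_empty, Set.subset_empty_iff, Finset.coe_eq_empty] at hts
    exact Or.inr hts

theorem IsTree.empty_mem {F : Set (Finset (Finset ℕ+))} (hT : IsTree F) : ∅ ∈ F := by
  rw [← hT]; exact Or.inr rfl

theorem IsTree.mem_of_isInitial {F : Set (Finset (Finset ℕ+))} (hT : IsTree F)
    {s t : Finset (Finset ℕ+)} (hs : s ∈ F) (ht : t ∈ finColl) (h : IsInitial t s) : t ∈ F := by
  rw [← hT]; exact Or.inl ⟨ht, s, hs, h⟩

theorem hereditaryPart_subset {F : Set (Finset (Finset ℕ+))} (h0 : ∅ ∈ F) :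
    hereditaryPart F ⊆ F := by
  rintro s (⟨h, _⟩ | rfl)
  · exact h
  · exact h0

theorem IsHereditary.mem_of_subset {G : Set (Finset (Finset ℕ+))} (hG : IsHereditary G)
    {s t : Finset (Finset ℕ+)} (hs : s ∈ G) (hsc : s ∈ finColl) (h : t ⊆ s) : t ∈ G :=
  hG s hs t (hsc.mono (Finset.coe_subset.2 h)) ((Finset.coe_subset.2 h).trans (subset_FU _))

/-- The minimum of a union of blocks is the minimum of one of them, and distinct blocks of a
disjoint collection have distinct minima. -/
theorem card_le_card_of_subset_FU {s t : Finset (Finset ℕ+)} (hs : s ∈ finColl)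
    (ht : t ∈ finColl) (h : (t : Set (Finset ℕ+)) ⊆ FU (s : Set (Finset ℕ+))) :
    t.card ≤ s.card := by
  rw [← Finset.card_image_of_injOn (injOn_minOf hs), ← Finset.card_image_of_injOn (injOn_minOf ht)]
  refine Finset.card_le_card fun m hm => ?_
  obtain ⟨u, hu, rfl⟩ := Finset.mem_image.1 hm
  have hmu := (isLeast_minOf (ht.1 u hu))
  obtain ⟨T, -, hT, rfl⟩ := h hu
  obtain ⟨a, ha, hma⟩ := Finset.mem_biUnion.1 hmu.1
  have has : a ∈ s := hT ha
  refine Finset.mem_image.2 ⟨a, has, le_antisymm ((isLeast_minOf (hs.1 a has)).2 hma) ?_⟩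
  exact hmu.2 (subset_supp ha (isLeast_minOf (hs.1 a has)).1)

theorem mem_closure_iff_finset {ι : Type*} {S : Set (ι → Bool)} {f : ι → Bool} :
    f ∈ closure S ↔ ∀ I : Finset ι, ∃ g ∈ S, ∀ i ∈ I, g i = f i := by
  rw [mem_closure_iff]
  constructor
  · intro h I
    obtain ⟨g, hg, hgS⟩ := h ((I : Set ι).pi fun i => {f i})
      (isOpen_set_pi I.finite_toSet fun _ _ => isOpen_discrete _) (fun i _ => rfl)
    exact ⟨g, hgS, fun i hi => hg i hi⟩
  · intro h o ho hfo
    obtain ⟨I, u, hu, hsub⟩ := isOpen_pi_iff.1 ho f hfo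
    obtain ⟨g, hgS, hg⟩ := h I
    exact ⟨g, hsub fun i hi => (hg i hi).symm ▸ (hu i hi).2, hgS⟩

/-- By heredity, all finite parts of the support of a limit point lie in the family. A finite
support is itself a member; an infinite one is the forbidden X. -/
theorem pointwiseClosed_iff {H : Set (Finset (Finset ℕ+))} (hH : IsHereditary H)
    (D : Set (Finset ℕ+)) :
    PointwiseClosed (H ∩ finCollIn D) ↔
      ¬ ∃ X ∈ infCollIn D, ∀ Y : Finset (Finset ℕ+), (Y : Set (Finset ℕ+)) ⊆ X → Y ∈ H := by
  constructor
  · rintro hcl ⟨X, hX, h⟩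
    classical
    have hmem : (fun a => decide (a ∈ X)) ∈ charFun '' (H ∩ finCollIn D) := by
      rw [← IsClosed.closure_eq hcl, mem_closure_iff_finset]
      intro I
      have hsub : ((I.filter (· ∈ X) : Finset (Finset ℕ+)) : Set (Finset ℕ+)) ⊆ X :=
        fun a ha => (Finset.mem_filter.1 (Finset.mem_coe.1 ha)).2
      refine ⟨_, ⟨_, ⟨h _ hsub, hX.1.2.mono hsub, hsub.trans hX.2⟩, rfl⟩, fun a ha => ?_⟩
      simp [charFun, ha]
    obtain ⟨s, -, hs⟩ := hmem
    refine hX.1.1 ((Finset.finite_toSet s).subset fun a ha => ?_)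
    have := congrFun hs a
    simpa [charFun, ha] using this
  · intro h
    refine isClosed_of_closure_subset fun f hf => ?_
    rw [mem_closure_iff_finset] at hf
    have hfin : ∀ Y : Finset (Finset ℕ+), (∀ a ∈ Y, f a = true) → Y ∈ H ∩ finCollIn D := by
      intro Y hY
      obtain ⟨_, ⟨s, hs, rfl⟩, hsY⟩ := hf Y
      have hYs : Y ⊆ s := fun a ha => by
        have := (hsY a ha).trans (hY a ha)
        simpa [charFun] using this
      exact ⟨hH.mem_of_subset hs.1 hs.2.1 hYs, hs.2.1.mono (Finset.coe_subset.2 hYs),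
        (Finset.coe_subset.2 hYs).trans hs.2.2⟩
    by_cases hinf : {a | f a = true}.Finite
    · refine ⟨hinf.toFinset, hfin _ fun a ha => by simpa using ha, ?_⟩
      funext a
      cases hfa : f a <;> simp [charFun, hfa]
    · refine absurd ⟨{a | f a = true}, ⟨⟨hinf, fun a ha => ?_, fun a ha b hb hab => ?_⟩,
        fun a ha => ?_⟩, fun Y hY => (hfin Y fun a ha => hY ha).1⟩ h
      · exact (hfin {a} (by simpa using ha)).2.1.1 a (by simp)
      · exact (hfin {a, b} (by simpa using ⟨ha, hb⟩)).2.1.2 (by simp) (by simp) hab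
      · exact (hfin {a} (by simpa using ha)).2.2 (by simp)

end BlockSchreier

namespace BlockSchreier

/-! ### Strong Cantor–Bendixson derivatives -/

section CantorBendixson

variable {D : Set (Finset ℕ+)} {G : Set (Finset (Finset ℕ+))}

/-- A set of nonempty blocks contains an infinite disjoint collection exactly when it has members
behind every finite set. The derivative condition thus says that all sufficiently late extensions
stay in `G`. -/
theorem mem_cbStep_iff (hD : D ∈ infColl) {s : Finset (Finset ℕ+)} :
    s ∈ cbStep D G ↔ s ∈ G ∧ s ∈ finCollIn D ∧
      ∃ a, ∀ t ∈ FU D, BlockLT a t → insert t s ∈ G := by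
  have hins : ∀ t, s ∪ {t} = insert t s := fun t => by rw [Finset.union_comm, Finset.insert_eq]
  constructor
  · rintro ⟨⟨h1, h2⟩, h3⟩
    refine ⟨h1, h2, ?_⟩
    by_contra! hcon
    refine h3 (exists_infColl_subset (fun t ht => nonempty_of_mem_FU hD.2.1 ht.1) fun a => ?_)
    obtain ⟨t, ht, hat, htG⟩ := hcon a
    exact ⟨t, ⟨ht, (hins t).symm ▸ htG⟩, hat⟩
  · rintro ⟨h1, h2, a, h3⟩
    refine ⟨⟨h1, h2⟩, ?_⟩
    rintro ⟨E, hE, hsub⟩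
    obtain ⟨t, ht, hat⟩ := exists_blockLT hE a
    exact (hsub ht).2 (hins t ▸ h3 t (hsub ht).1 hat)

variable (D G) in
theorem cbDeriv_zero : cbDeriv D G 0 = G := Ordinal.limitRecOn_zero _ _ _

variable (D G) in
theorem cbDeriv_add_one (ξ : Ordinal.{0}) :
    cbDeriv D G (ξ + 1) = cbStep D (cbDeriv D G ξ) := Ordinal.limitRecOn_add_one _ _ _ _

theorem mem_cbDeriv_limit {ξ : Ordinal.{0}} (hξ : Order.IsSuccLimit ξ)
    {s : Finset (Finset ℕ+)} : s ∈ cbDeriv D G ξ ↔ ∀ β < ξ, s ∈ cbDeriv D G β := by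
  rw [cbDeriv, Ordinal.limitRecOn_limit _ _ _ _ hξ]
  simp only [Set.mem_iInter]
  rfl

theorem cbDeriv_antitone {ξ η : Ordinal.{0}} (h : η ≤ ξ) : cbDeriv D G ξ ⊆ cbDeriv D G η := by
  induction ξ using Ordinal.limitRecOn with
  | zero => rw [nonpos_iff_eq_zero.1 h]
  | add_one ζ ih =>
    rcases h.eq_or_lt with rfl | h
    · exact Set.Subset.rfl
    · rw [cbDeriv_add_one]
      exact fun s hs => ih (Order.lt_add_one_iff.1 h) hs.1.1
  | limit ξ hξ _ =>
    rcases h.eq_or_lt with rfl | h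
    · exact Set.Subset.rfl
    · exact fun s hs => (mem_cbDeriv_limit hξ).1 hs η h

theorem cbDeriv_subset (ξ : Ordinal.{0}) : cbDeriv D G ξ ⊆ G := by
  simpa only [cbDeriv_zero] using cbDeriv_antitone (D := D) (G := G) (zero_le (a := ξ))

theorem isHereditary_cbDeriv (hG : IsHereditary G) (hD : D ∈ infColl) (ξ : Ordinal.{0}) :
    IsHereditary (cbDeriv D G ξ) := by
  induction ξ using Ordinal.limitRecOn with
  | zero => rwa [cbDeriv_zero]
  | add_one ζ ih =>
    rw [cbDeriv_add_one]
    intro s hs t ht hts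
    rw [mem_cbStep_iff hD] at hs ⊢
    obtain ⟨h1, h2, a, h3⟩ := hs
    refine ⟨ih s h1 t ht hts, ⟨ht, hts.trans (FU_subset_FU h2.2)⟩, a ∪ supp s, fun u hu hau => ?_⟩
    rw [blockLT_union] at hau
    refine ih _ (h3 u hu hau.1) _ (mem_finColl_insert ht (nonempty_of_mem_FU hD.2.1 hu)
      (hau.2.mono (supp_subset_supp hts) Finset.Subset.rfl)) ?_
    rw [Finset.coe_insert, Finset.coe_insert]
    exact Set.insert_subset (subset_FU _ (Set.mem_insert _ _))
      (hts.trans (FU_mono (Set.subset_insert _ _)))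
  | limit ξ hξ ih =>
    intro s hs t ht hts
    rw [mem_cbDeriv_limit hξ] at hs ⊢
    exact fun β hβ => ih β hβ s (hs β hβ) t ht hts

theorem IsHereditary.empty_mem_cbDeriv (hG : IsHereditary G) (hD : D ∈ infColl)
    {ξ : Ordinal.{0}} (h : cbDeriv D G ξ ≠ ∅) : ∅ ∈ cbDeriv D G ξ := by
  obtain ⟨s, hs⟩ := Set.nonempty_iff_ne_empty.2 h
  exact isHereditary_cbDeriv hG hD ξ s hs ∅ empty_mem_finColl (by simp)

/-- On a smaller collection fewer extensions are tested, so survival is inherited. -/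
theorem mem_cbDeriv_of_mem {D₁ : Set (Finset ℕ+)} (hD : D ∈ infColl) (hD₁ : D₁ ∈ infCollIn D)
    {ξ : Ordinal.{0}} {s : Finset (Finset ℕ+)} (hs : s ∈ cbDeriv D G ξ)
    (hsD : s ∈ finCollIn D₁) : s ∈ cbDeriv D₁ G ξ := by
  induction ξ using Ordinal.limitRecOn generalizing s with
  | zero => rwa [cbDeriv_zero] at hs ⊢
  | add_one ζ ih =>
    rw [cbDeriv_add_one] at hs ⊢
    rw [mem_cbStep_iff hD] at hs
    rw [mem_cbStep_iff hD₁.1]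
    obtain ⟨h1, h2, a, h3⟩ := hs
    refine ⟨ih h1 hsD, hsD, a ∪ supp s, fun t ht hat => ?_⟩
    rw [blockLT_union] at hat
    exact ih (h3 t (FU_subset_FU hD₁.2 ht) hat.1) (insert_mem_finCollIn hD₁.1 hsD ht hat.2)
  | limit ξ hξ ih =>
    rw [mem_cbDeriv_limit hξ] at hs ⊢
    exact fun β hβ => ih β hβ (hs β hβ) hsD

/-- The blocks appended along an infinite descending chain would form an infinite collection with
all finite parts in `G`. -/
theorem IsHereditary.wellFounded_insert (hG : IsHereditary G) (hD : D ∈ infColl)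
    (hX : ¬ ∃ X ∈ infCollIn D, ∀ Y : Finset (Finset ℕ+), (Y : Set (Finset ℕ+)) ⊆ X → Y ∈ G) :
    WellFounded fun u s : Finset (Finset ℕ+) => s ∈ finCollIn D ∧
      ∃ t ∈ FU D, BlockLT (supp s) t ∧ u = insert t s ∧ u ∈ G := by
  rw [wellFounded_iff_isEmpty_descending_chain]
  refine ⟨fun ⟨f, hf⟩ => hX ?_⟩
  have hfin : ∀ n, f n ∈ finCollIn D := fun n => (hf n).1
  choose _ t ht hlt hins hfG using hf
  have hmono : Monotone f := monotone_nat_of_le_succ fun n => by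
    rw [hins n]; exact Finset.subset_insert _ _
  have htf : ∀ m n, m < n → t m ∈ f n := fun m n hmn =>
    hmono (Nat.succ_le_of_lt hmn) (by rw [Nat.succ_eq_add_one, hins m]; simp)
  refine ⟨Set.range t, ⟨range_mem_infColl (fun n => nonempty_of_mem_FU hD.2.1 (ht n))
    fun m n hmn => blockLT_supp.1 (hlt n) _ (htf m n hmn), Set.range_subset_iff.2 ht⟩,
    fun Y hY => ?_⟩
  rw [← Set.image_univ] at hY
  obtain ⟨I, -, rfl⟩ := Finset.subset_set_image_iff.1 hY
  obtain ⟨N, hN⟩ := I.bddAbove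
  refine hG.mem_of_subset (hfG N) (hfin _).1 fun a ha => ?_
  obtain ⟨i, hi, rfl⟩ := Finset.mem_image.1 ha
  exact htf i _ (Nat.lt_succ_of_le (hN hi))

/-- If no infinite disjoint collection has all its finite parts in the hereditary family `G`, then
the indices of `G` on the subcollections of `D` have a common countable bound. -/
theorem IsHereditary.exists_cbDeriv_eq_empty (hG : IsHereditary G) (hD : D ∈ infColl)
    (hX : ¬ ∃ X ∈ infCollIn D, ∀ Y : Finset (Finset ℕ+), (Y : Set (Finset ℕ+)) ⊆ X → Y ∈ G) :
    ∃ ρ < ω_ 1, ∀ D₁ ∈ infCollIn D, cbDeriv D₁ G ρ = ∅ := by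
  have key : ∀ s ∈ finCollIn D,
      ∃ ρ < ω_ 1, ∀ D₁ ∈ infCollIn D, s ∉ cbDeriv D₁ G ρ := by
    intro s
    induction s using (hG.wellFounded_insert hD hX).induction with
    | _ s ih =>
    intro hs
    have hbound : ∀ t : Finset ℕ+, ∃ ρ < ω_ 1, t ∈ FU D → BlockLT (supp s) t → insert t s ∈ G →
        ∀ D₁ ∈ infCollIn D, insert t s ∉ cbDeriv D₁ G ρ := by
      intro t
      by_cases ht : t ∈ FU D ∧ BlockLT (supp s) t ∧ insert t s ∈ G
      · obtain ⟨ρ, hρ, h⟩ := ih _ ⟨hs, t, ht.1, ht.2.1, rfl, ht.2.2⟩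
          (insert_mem_finCollIn hD hs ht.1 ht.2.1)
        exact ⟨ρ, hρ, fun _ _ _ => h⟩
      · exact ⟨0, Ordinal.omega_pos 1, fun h1 h2 h3 => absurd ⟨h1, h2, h3⟩ ht⟩
    choose ρ hρ h using hbound
    -- There are countably many blocks t, so the supremum is countable. Surviving one more
    -- derivative would require some extension to survive to the supremum.
    refine ⟨(⨆ t, ρ t) + 1, Ordinal.isPrincipal_add_omega 1 (Ordinal.iSup_lt_omega_one hρ)
      (Ordinal.one_lt_omega0.trans Ordinal.omega0_lt_omega_one), fun D₁ hD₁ hmem => ?_⟩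
    rw [cbDeriv_add_one, mem_cbStep_iff hD₁.1] at hmem
    obtain ⟨-, h2, a, h3⟩ := hmem
    obtain ⟨t, ht, hat⟩ := exists_blockLT hD₁.1 (a ∪ supp s)
    rw [blockLT_union] at hat
    have h4 := h3 t (subset_FU _ ht) hat.1
    exact h t (hD₁.2 ht) hat.2 (cbDeriv_subset _ h4) D₁ hD₁
      (cbDeriv_antitone (Ordinal.le_iSup ρ t) h4)
  obtain ⟨ρ, hρ, h⟩ := key ∅ ⟨empty_mem_finColl, by simp⟩
  refine ⟨ρ, hρ, fun D₁ hD₁ => ?_⟩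
  by_contra hne
  exact h D₁ hD₁ (hG.empty_mem_cbDeriv hD₁.1 hne)

/-- The hypothesis excludes the default value `sInf ∅ = 0`. -/
theorem lt_cbIndex_iff {ξ : Ordinal.{0}} (h : ∃ ρ < ω_ 1, cbDeriv D G ρ = ∅) :
    ξ < cbIndex D G ↔ cbDeriv D G ξ ≠ ∅ := by
  obtain ⟨ρ, hρ, hρ0⟩ := h
  have hmem := csInf_mem (s := {ξ | ξ < ω_ 1 ∧ cbDeriv D G ξ = ∅}) ⟨ρ, hρ, hρ0⟩
  constructor
  · intro hlt h0
    exact hlt.not_ge (csInf_le' ⟨hlt.trans hmem.1, h0⟩)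
  · intro hne
    by_contra hle
    exact hne (Set.subset_empty_iff.1 (hmem.2 ▸ cbDeriv_antitone (not_lt.1 hle)))

variable {lam : Ordinal.{0} → ℕ+ → Ordinal.{0}}

/-- If no member of `𝓑^ξ` on `D` belongs to the hereditary family `G`, then the derivatives of `G`
decrease at least as fast as those of the initial segments of `𝓑^ξ`. -/
theorem IsHereditary.add_le_of_mem_cbDeriv (hG : IsHereditary G) (hD : D ∈ infColl)
    {ξ : Ordinal.{0}} (hno : ∀ s ∈ finCollIn D, Reach lam ξ (mins s) 0 → s ∉ G)
    {η : Ordinal.{0}} {s : Finset (Finset ℕ+)} (hs : s ∈ cbDeriv D G η)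
    (hsD : s ∈ finCollIn D) : ∃ ρ, Reach lam ξ (mins s) ρ ∧ 1 + η ≤ ρ := by
  -- Otherwise an initial segment of `s` would lie in 𝓑^ξ and, by heredity, in `G`. The nonzero
  -- residual accounts for the 1 in 1 + η.
  have hreach : ∀ s ∈ G, s ∈ finCollIn D → ∃ ρ, ρ ≠ 0 ∧ Reach lam ξ (mins s) ρ := by
    intro s hs hsD
    refine (reach_or_isInitial lam ξ hsD.1).resolve_right ?_
    rintro ⟨t, hts, ht⟩
    exact hno t (hts.mem_finCollIn hsD) ht (hG.mem_of_subset hs hsD.1 hts.1)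
  induction η using Ordinal.limitRecOn generalizing s with
  | zero =>
    rw [cbDeriv_zero] at hs
    obtain ⟨ρ, hρ, h⟩ := hreach s hs hsD
    exact ⟨ρ, h, by simpa using Order.one_le_iff_pos.2 (pos_iff_ne_zero.2 hρ)⟩
  | add_one ζ ih =>
    rw [cbDeriv_add_one, mem_cbStep_iff hD] at hs
    obtain ⟨h1, -, a, h3⟩ := hs
    obtain ⟨ρ, hρ, h⟩ := hreach s (cbDeriv_subset _ h1) hsD
    obtain ⟨t, ht, hat⟩ := exists_blockLT hD (a ∪ supp s)
    rw [blockLT_union] at hat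
    have htFU := subset_FU D ht
    obtain ⟨σ, hσ, hle⟩ := ih (h3 t htFU hat.1) (insert_mem_finCollIn hD hsD htFU hat.2)
    rw [hσ.unique (h.insert_block hρ hsD.1 (hD.2.1 t ht) hat.2)] at hle
    refine ⟨ρ, h, ?_⟩
    rw [← add_assoc, Order.add_one_le_iff]
    exact hle.trans_lt (fundSeq_lt lam hρ _)
  | limit η hη ih =>
    have hs' := (mem_cbDeriv_limit hη).1 hs
    obtain ⟨ρ, hρ, h⟩ := hreach s (cbDeriv_subset _ hs) hsD
    refine ⟨ρ, h, ?_⟩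
    refine (Ordinal.add_le_iff_of_isSuccLimit hη).2 fun β hβ => ?_
    obtain ⟨σ, hσ, hle⟩ := ih β hβ (hs' β hβ) hsD
    rwa [hσ.unique h] at hle

/-- If all members of `𝓑^ξ` on `D` belong to the hereditary family `G`, then the derivatives of `G`
decrease at most as fast as those of the initial segments of `𝓑^ξ`. -/
theorem IsHereditary.mem_cbDeriv_of_reach (hlam : IsFundamentalSystem lam)
    (hG : IsHereditary G) (hD : D ∈ infColl) {ξ : Ordinal.{0}} (hξ : ξ < ω_ 1)
    (hall : ∀ s ∈ finCollIn D, Reach lam ξ (mins s) 0 → s ∈ G)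
    {η ρ : Ordinal.{0}} {s : Finset (Finset ℕ+)} (h : Reach lam ξ (mins s) ρ) (hηρ : η ≤ ρ)
    (hsD : s ∈ finCollIn D) : s ∈ cbDeriv D G η := by
  induction η using Ordinal.limitRecOn generalizing s ρ with
  | zero =>
    rw [cbDeriv_zero]
    obtain ⟨u, hu, hsu, hR⟩ := h.exists_extension hD hsD
    exact hG.mem_of_subset (hall u hu hR) hu.1 hsu.1
  | add_one ζ ih =>
    rw [cbDeriv_add_one, mem_cbStep_iff hD]
    have hlt : ζ < ρ := Order.add_one_le_iff.1 hηρ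
    -- Blocks behind `N` leave a residual of at least ζ, and the derivative tests only late blocks.
    obtain ⟨N, hN⟩ := eventually_le_fundSeq hlam (h.le.trans_lt hξ) hlt
    refine ⟨ih h hlt.le hsD, hsD, {N} ∪ supp s, fun t ht hat => ?_⟩
    rw [blockLT_union] at hat
    have htne := nonempty_of_mem_FU hD.2.1 ht
    refine ih (h.insert_block (pos_of_gt hlt).ne' hsD.1 htne hat.2) (hN _ ?_)
      (insert_mem_finCollIn hD hsD ht hat.2)
    exact (hat.1 N (Finset.mem_singleton_self N) _ (isLeast_minOf htne).1).le
  | limit η hη ih =>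
    rw [mem_cbDeriv_limit hη]
    exact fun β hβ => ih β hβ h (hβ.le.trans hηρ) hsD

end CantorBendixson

/-- If all members of `𝓑^ξ` on `D` belong to the tree `F`, then some of them belong to the largest
hereditary subfamily of `F`. -/
theorem IsTree.exists_mem_hereditaryPart {lam : Ordinal.{0} → ℕ+ → Ordinal.{0}}
    {F : Set (Finset (Finset ℕ+))} (hT : IsTree F) {D : Set (Finset ℕ+)} (hD : D ∈ infColl)
    {ξ : Ordinal.{0}} (hall : ∀ s ∈ finCollIn D, Reach lam ξ (mins s) 0 → s ∈ F) :
    ∃ s ∈ finCollIn D, Reach lam ξ (mins s) 0 ∧ s ∈ hereditaryPart F := by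
  classical
  -- Choose a member s of 𝓑^ξ on `D` with fewest blocks. A collection t in FU(s) has no more blocks
  -- than s. Either t extends to a member of 𝓑^ξ, and the tree property applies, or t has an initial
  -- segment in 𝓑^ξ, which by minimality is all of t.
  have hex : ∃ n, ∃ s ∈ finCollIn D, Reach lam ξ (mins s) 0 ∧ s.card = n := by
    obtain ⟨u, hu, -, hR⟩ := Reach.exists_extension (lam := lam) (ξ := ξ) hD (s := ∅) Reach.nil
      ⟨empty_mem_finColl, by simp⟩
    exact ⟨_, u, hu, hR, rfl⟩
  obtain ⟨s, hs, hR, hcard⟩ := Nat.find_spec hex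
  refine ⟨s, hs, hR, Or.inl ⟨hall s hs hR, fun t ht hts => ?_⟩⟩
  have htD : t ∈ finCollIn D := ⟨ht, hts.trans (FU_subset_FU hs.2)⟩
  rcases reach_or_isInitial lam ξ ht with ⟨ρ, -, h⟩ | ⟨u, hut, hu⟩
  · obtain ⟨v, hv, htv, hRv⟩ := h.exists_extension hD htD
    exact hT.mem_of_isInitial (hall v hv hRv) ht htv
  · have huD := hut.mem_finCollIn htD
    have h1 : Nat.find hex ≤ u.card := Nat.find_min' hex ⟨u, huD, hu, rfl⟩
    have h2 := card_le_card_of_subset_FU hs.1 ht hts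
    have : u = t := Finset.eq_of_subset_of_card_le hut.1 (by omega)
    exact this ▸ hall u huD hu

end BlockSchreier

/-! ### Assembly of the two cases. -/

open BlockSchreier in
theorem theorem3p3 (lam : Ordinal.{0} → ℕ+ → Ordinal.{0}) (hlam : IsFundamentalSystem lam)
    (F : Set (Finset (Finset ℕ+))) (hF : F ⊆ finColl) (hT : IsTree F)
    (D : Set (Finset ℕ+)) (hD : D ∈ infColl) :
    (¬ PointwiseClosed (hereditaryPart F ∩ finCollIn D) →
      ∃ D₁ ∈ infCollIn D, finCollIn D₁ ⊆ F) ∧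
    (PointwiseClosed (hereditaryPart F ∩ finCollIn D) →
      -- all the indices are well defined, and their supremum is a countable ordinal
      (∀ D₁ ∈ infCollIn D, ∃ η < ω_ 1, cbDeriv D₁ (hereditaryPart F) η = ∅) ∧
      cbSup D (hereditaryPart F) < ω_ 1 ∧
      ∀ ξ : Ordinal.{0}, ξ < ω_ 1 →
        (ξ + 1 < cbSup D (hereditaryPart F) →
          ∃ D₂ ∈ infCollIn D, blockSchreier lam ξ ∩ finCollIn D₂ ⊆ F) ∧
        (cbSup D (hereditaryPart F) < ξ →
          ∀ D₁ ∈ infCollIn D, ∃ D₂ ∈ infCollIn D₁,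
            blockSchreier lam ξ ∩ finCollIn D₂ ⊆ finColl \ F ∧
            F ∩ finCollIn D₂ ⊆ initialClosure (blockSchreier lam ξ) \ blockSchreier lam ξ) ∧
        (ξ + 1 = cbSup D (hereditaryPart F) ∨ ξ = cbSup D (hereditaryPart F) →
          ∃ D₂ ∈ infCollIn D,
            blockSchreier lam ξ ∩ finCollIn D₂ ⊆ F ∨
            blockSchreier lam ξ ∩ finCollIn D₂ ⊆ finColl \ F)) := by
  have h0 : ∅ ∈ F := hT.empty_mem
  have hH : IsHereditary (hereditaryPart F) := isHereditary_hereditaryPart F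
  have hHF : hereditaryPart F ⊆ F := hereditaryPart_subset h0
  rw [pointwiseClosed_iff hH]
  refine ⟨fun h => ?_, fun hX => ?_⟩
  · obtain ⟨X, hX, hfin⟩ := not_not.1 h
    refine ⟨X, hX, fun s hs => hHF ?_⟩
    have hgen : ∀ u ∈ s, ∃ T : Finset (Finset ℕ+), (T : Set (Finset ℕ+)) ⊆ X ∧
        u ∈ FU (T : Set (Finset ℕ+)) := by
      intro u hu
      obtain ⟨T, hT, hTX, rfl⟩ := hs.2 hu
      exact ⟨T, hTX, T, hT, subset_rfl, rfl⟩
    choose! T hTX hTu using hgen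
    have hsub : ((s.biUnion T : Finset (Finset ℕ+)) : Set (Finset ℕ+)) ⊆ X := by
      intro d hd
      obtain ⟨u, hu, hdu⟩ := Finset.mem_biUnion.1 (Finset.mem_coe.1 hd)
      exact hTX u hu hdu
    refine hH _ (hfin _ hsub) s hs.1 fun u hu => FU_mono ?_ (hTu u hu)
    exact Finset.coe_subset.2 (Finset.subset_biUnion_of_mem T hu)
  · obtain ⟨ρ, hρ, hempty⟩ := hH.exists_cbDeriv_eq_empty hD hX
    have hdef : ∀ D₁ ∈ infCollIn D, ∃ η < ω_ 1, cbDeriv D₁ (hereditaryPart F) η = ∅ :=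
      fun D₁ hD₁ => ⟨ρ, hρ, hempty D₁ hD₁⟩
    have hle : ∀ η ∈ {η | ∃ D₁ ∈ infCollIn D, η = cbIndex D₁ (hereditaryPart F)}, η ≤ ρ := by
      rintro _ ⟨D₁, hD₁, rfl⟩
      exact csInf_le' ⟨hρ, hempty D₁ hD₁⟩
    have hne : {η | ∃ D₁ ∈ infCollIn D, η = cbIndex D₁ (hereditaryPart F)}.Nonempty :=
      ⟨_, D, infCollIn_self hD, rfl⟩
    refine ⟨hdef, (csSup_le hne hle).trans_lt hρ, fun ξ hξ => ⟨fun hlt => ?_, fun hlt => ?_,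
      fun _ => ?_⟩⟩
    · obtain ⟨_, ⟨D₁, hD₁, rfl⟩, hlt₁⟩ := exists_lt_of_lt_csSup hne hlt
      rw [lt_cbIndex_iff (hdef D₁ hD₁)] at hlt₁
      obtain ⟨D₂, hD₂, hall | hnone⟩ := exists_homogeneous lam ξ (hereditaryPart F) hD₁.1
      · refine ⟨D₂, infCollIn_trans hD₁ hD₂, fun s hs => hHF (hall s hs.2 ?_)⟩
        exact ((mem_blockSchreier_iff hlam hξ).1 hs.1).2
      -- The empty collection survives to stage ξ + 1, so missing 𝓑^ξ would give 1 + (ξ + 1) ≤ ξ.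
      · have hmem := mem_cbDeriv_of_mem hD₁.1 hD₂ (hH.empty_mem_cbDeriv hD₁.1 hlt₁)
          ⟨empty_mem_finColl, by simp⟩
        obtain ⟨σ, hσ, hle'⟩ := hH.add_le_of_mem_cbDeriv hD₂.1 hnone hmem
          ⟨empty_mem_finColl, by simp⟩
        rw [hσ.of_empty, ← add_assoc, Order.add_one_le_iff] at hle'
        exact absurd hle' le_add_self.not_gt
    · intro D₁ hD₁
      obtain ⟨D₂, hD₂, hF₂⟩ := exists_homogeneous lam ξ F hD₁.1
      rcases hF₂ with hall | hnone
      -- If 𝓑^ξ were inside `F` on `D₂`, homogenise once more for F_h. Containment in F_h gives an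
      -- index above ξ, hence above the supremum; avoidance contradicts the member of F_h with
      -- fewest blocks.
      · exfalso
        obtain ⟨D₃, hD₃, hall' | hnone'⟩ := exists_homogeneous lam ξ (hereditaryPart F) hD₂.1
        · have hD₃D := infCollIn_trans hD₁ (infCollIn_trans hD₂ hD₃)
          have hmem := hH.mem_cbDeriv_of_reach hlam hD₃.1 hξ hall' (s := ∅) Reach.nil le_rfl
            ⟨empty_mem_finColl, by simp⟩
          have h1 := (lt_cbIndex_iff (hdef D₃ hD₃D)).2 (Set.nonempty_iff_ne_empty.1 ⟨_, hmem⟩)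
          exact (h1.trans_le (le_csSup ⟨ρ, hle⟩ ⟨D₃, hD₃D, rfl⟩)).not_gt hlt
        · obtain ⟨s, hs, hR, hsH⟩ := hT.exists_mem_hereditaryPart hD₃.1
            fun s hs => hall s (finCollIn_mono hD₃.2 hs)
          exact hnone' s hs hR hsH
      · have hnot : ∀ s ∈ finCollIn D₂, s ∈ blockSchreier lam ξ → s ∉ F := fun s hs hB =>
          hnone s hs ((mem_blockSchreier_iff hlam hξ).1 hB).2
        refine ⟨D₂, hD₂, fun s hs => ⟨hs.2.1, hnot s hs.2 hs.1⟩, fun s hs =>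
          ⟨?_, fun hB => hnot s hs.2 hB hs.1⟩⟩
        rcases reach_or_isInitial lam ξ hs.2.1 with ⟨σ, -, h⟩ | ⟨t, hts, ht⟩
        · obtain ⟨u, hu, hsu, hR⟩ := h.exists_extension hD₂.1 hs.2
          exact Or.inl ⟨hs.2.1, u, (mem_blockSchreier_iff hlam hξ).2 ⟨hu.1, hR⟩, hsu⟩
        · have htD := hts.mem_finCollIn hs.2
          exact absurd (hT.mem_of_isInitial hs.1 htD.1 hts) (hnone t htD ht)
    · obtain ⟨D₂, hD₂, h⟩ := exists_homogeneous lam ξ F hD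
      refine ⟨D₂, hD₂, h.imp (fun h s hs => ?_) fun h s hs => ⟨hs.2.1, ?_⟩⟩
      · exact h s hs.2 ((mem_blockSchreier_iff hlam hξ).1 hs.1).2
      · exact h s hs.2 ((mem_blockSchreier_iff hlam hξ).1 hs.1).2
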